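/- For a positive integer $n$, let $\mathcal A_n$ be the family of all arithmetic progressions in $\mathbb Z_n=\mathbb Z/n\mathbb Z$, that is, of all sets $\{a+kd: 0\le k<l\}$ with $a,d\in\mathbb Z_n$ and an integer $l\ge 0$, and let $$\operatorname{disc}(\mathcal A_n)=\min_{\chi:\mathbb Z_n\to\{1,-1\}}\ \max_{A\in\mathcal A_n}\Bigl|\sum_{y\in A}\chi(y)\Bigr|.$$ Let $d(n)$ be the number of positive divisors of $n$ and $\omega(n)$ the number of distinct prime factors of $n$. 1. There is an absolute constant $c>0$ such that for every positive integer $n$, $$\frac{1}{8\sqrt{d(n)}}\cdot\min_{r\mid n}\Bigl(\frac nr+\sqrt r\Bigr)\ \le\ \operatorname{disc}(\mathcal A_n)\ \le\ \min_{r\mid n}\Bigl(\frac nr+c\sqrt r\cdot 2^{\omega(r)}\Bigr),$$ where $r$ ranges over the positive divisors of $n$. 2. For every $n\ge 2$ there is a largest real number $x=x(n)\ge 0$ such that no positive divisor of $n$ lies in the open interval $(n^{2/3-x},\,n^{2/3+2x})$, and $\operatorname{disc}(\mathcal A_n)=n^{1/3+x(n)+o(1)}$, where the term $o(1)$ tends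 to $0$ as $n\to\infty$. 3. There are absolute constants $c_1,c_2>0$ such that $c_1\sqrt n\le\operatorname{disc}(\mathcal A_n)\le c_2\sqrt n$ for every prime $n$. -/

import Mathlib

open scoped ArithmeticFunction.omega

noncomputable section

/-- The discrepancy of a family `𝒜` of subsets of a finite set `Ω`: the minimum, over all colorings
`χ : Ω → {1, -1}` (the units of `ℤ`), of the maximum over `A ∈ 𝒜` of `|∑ x ∈ A, χ x|`. -/
def disc {Ω : Type*} [Fintype Ω] [DecidableEq Ω] (𝒜 : Finset (Finset Ω)) : ℕ :=
  (Finset.univ : Finset (Ω → ℤˣ)).inf' Finset.univ_nonempty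
    fun χ => 𝒜.sup fun A => (∑ x ∈ A, (χ x : ℤ)).natAbs

open Classical in
/-- The family of all arithmetic progressions `{a + k d : 0 ≤ k < l}` in `ℤ/nℤ`, where
`a, d ∈ ℤ/nℤ` and `l ≥ 0`. They are sets: repeated elements are counted once. -/
def modularAPs (n : ℕ) [NeZero n] : Finset (Finset (ZMod n)) :=
  Finset.univ.filter fun A =>
    ∃ (a d : ZMod n) (l : ℕ), A = (Finset.range l).image fun k : ℕ => a + (k : ZMod n) * d

/-- The minimum of `f r` over the positive divisors `r` of the positive integer `n`. -/
def minOverDivisors (n : ℕ) [NeZero n] (f : ℕ → ℝ) : ℝ :=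
  n.divisors.inf' (Nat.nonempty_divisors.2 (NeZero.ne n)) f

/-- The real numbers `x ≥ 0` such that no factor of `n` lies in the open interval
`(n ^ (2/3 - x), n ^ (2/3 + 2x))`. -/
def divisorGaps (n : ℕ) : Set ℝ :=
  {x | 0 ≤ x ∧ ∀ r ∈ n.divisors,
    (r : ℝ) ∉ Set.Ioo ((n : ℝ) ^ (2 / 3 - x : ℝ)) ((n : ℝ) ^ (2 / 3 + 2 * x : ℝ))}

end

/-! Upper bound: for a divisor `r` of `n`, color `y` by `f (y % r)`, where `f` is a `±1` coloring of
`ℤ/rℤ` whose sum over every coset of a subgroup is at most `1` in absolute value and whose sums over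
pieces of cycles of a translation are `O(2 ^ ω r * √r)`. A progression in `ℤ/nℤ` without repetitions
runs around a cycle modulo `r` at most `n / r` times, up to incomplete pieces. Full turns cost `1`
each, and incomplete pieces cost `O(2 ^ ω r * √r)`. To build `f`, tie the elements of `ℤ/rℤ`
together with signs in classes of size at most `2 ^ ω r`, so that coset sums are small whatever
values the classes receive (`hasBalancedGrouping`). The class values are then chosen by discrepancy
theory: `exists_partial_coloring` fixes half of the live variables at a time, and dyadic blocks
control all prefixes of the `r` cycle enumerations (`exists_coloring_of_sequences`). With `r`
sequences and `r` variables the bound `(r * r) ^ (1/4)` is `√r`. Lower bound: by Parseval the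
Fourier mass of `χ` is `n ^ 2`, and some additive order `r` carries at least the fraction `1 / d(n)`
of it. Cosets of the subgroup generated by `r` detect this mass with multiplier `n / r`.
Progressions of length about `r / 3` with differences coprime to `r` detect it with multiplier at
least `r / 6`, after a loss of at most `r` for the choice of difference. Hence `n / r` and `√r / 6`
are both at most `√d(n) * disc`. The second part compares exponents: with `r = n ^ ρ`, the larger of
`1 - ρ` and `ρ / 2` is `1/3` plus `gapExponent n r`, and `d(n)` and `2 ^ ω r` are `n ^ o(1)`. For a
prime `n` there are only two divisors, and both sides have order `√n`. -/

/-! ### Partial coloring by a second-order optimality condition. -/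

-- A trace comparison: sum the quadratic inequality over an orthonormal basis of `W` and apply
-- Bessel's inequality to each `a i`.
open scoped RealInnerProductSpace in
theorem finrank_le_of_norm_sq_le_sum {V I : Type*} [Fintype V] [Fintype I]
    (a : I → EuclideanSpace ℝ V) (c : I → ℝ) (hc : ∀ i, 0 ≤ c i)
    (W : Submodule ℝ (EuclideanSpace ℝ V))
    (hW : ∀ v ∈ W, ‖v‖ ^ 2 ≤ ∑ i, c i * ⟪v, a i⟫ ^ 2) :
    (Module.finrank ℝ W : ℝ) ≤ ∑ i, c i * ‖a i‖ ^ 2 := by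
  set e := stdOrthonormalBasis ℝ W
  have he : Orthonormal ℝ (fun k => (e k : EuclideanSpace ℝ V)) :=
    e.orthonormal.comp_linearIsometry W.subtypeₗᵢ
  calc (Module.finrank ℝ W : ℝ) = ∑ k, ‖(e k : EuclideanSpace ℝ V)‖ ^ 2 := by
        simp [he.1]
    _ ≤ ∑ k, ∑ i, c i * ⟪(e k : EuclideanSpace ℝ V), a i⟫ ^ 2 :=
        Finset.sum_le_sum fun k _ => hW _ (e k).2
    _ = ∑ i, c i * ∑ k, ⟪(e k : EuclideanSpace ℝ V), a i⟫ ^ 2 := by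
        rw [Finset.sum_comm]
        simp_rw [Finset.mul_sum]
    _ ≤ ∑ i, c i * ‖a i‖ ^ 2 := by
        refine Finset.sum_le_sum fun i _ => mul_le_mul_of_nonneg_left ?_ (hc i)
        have := he.sum_inner_products_le (a i) (s := Finset.univ)
        simpa using this

open scoped RealInnerProductSpace in
theorem card_le_card_add_finrank {V I : Type*} [Fintype V] [DecidableEq V]
    (a : I → EuclideanSpace ℝ V) (F : Finset V) (T : Finset I) :
    ∃ W : Submodule ℝ (EuclideanSpace ℝ V),
      (∀ v ∈ W, (∀ j ∉ F, v j = 0) ∧ ∀ i ∈ T, ⟪v, a i⟫ = 0) ∧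
      F.card ≤ T.card + Module.finrank ℝ W := by
  classical
  let f : EuclideanSpace ℝ V →ₗ[ℝ] ({j // j ∈ Fᶜ} → ℝ) × ({i // i ∈ T} → ℝ) :=
    { toFun := fun v => (fun j => v j, fun i => ⟪v, a i⟫)
      map_add' := fun x y => by
        ext <;> simp [inner_add_left]
      map_smul' := fun c x => by
        ext <;> simp [real_inner_smul_left] }
  refine ⟨LinearMap.ker f, fun v hv => ?_, ?_⟩
  · rw [LinearMap.mem_ker] at hv
    refine ⟨fun j hj => ?_, fun i hi => ?_⟩
    · exact congrFun (congrArg Prod.fst hv) ⟨j, by simpa using hj⟩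
    · exact congrFun (congrArg Prod.snd hv) ⟨i, hi⟩
  · have h1 := f.finrank_range_add_finrank_ker
    have h2 := Submodule.finrank_le (LinearMap.range f)
    have h3 : Module.finrank ℝ (({j // j ∈ Fᶜ} → ℝ) × ({i // i ∈ T} → ℝ))
        = Fᶜ.card + T.card := by
      rw [Module.finrank_prod, Module.finrank_fintype_fun_eq_card,
        Module.finrank_fintype_fun_eq_card, Fintype.card_coe, Fintype.card_coe]
    have h4 := Finset.card_add_card_compl F
    rw [finrank_euclideanSpace] at h1
    omega

set_option maxHeartbeats 1000000 in
open scoped RealInnerProductSpace in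
/-- Partial coloring: a fractional coloring can be moved, with each linear form `a i` changing by
at most `D i`, so that at least half of the live coordinates become `±1`. -/
theorem exists_partial_coloring {V I : Type*} [Fintype V] [DecidableEq V] [Fintype I]
    (U : Finset V) (a : I → EuclideanSpace ℝ V) (L D : I → ℝ) (hD : ∀ i, 0 < D i)
    (hL : ∀ i, ‖a i‖ ^ 2 ≤ L i) (hsum : ∑ i, L i ^ 2 / D i ^ 4 ≤ U.card / 2304)
    (x₀ : EuclideanSpace ℝ V) (hx₀ : ∀ v, |x₀ v| ≤ 1) :
    ∃ x : EuclideanSpace ℝ V, (∀ v, |x v| ≤ 1) ∧ (∀ v ∉ U, x v = x₀ v) ∧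
      (∀ i, |⟪x - x₀, a i⟫| ≤ D i) ∧ 2 * (U.filter fun v => |x v| < 1).card ≤ U.card := by
  classical
  set P : Set (EuclideanSpace ℝ V) := {x | (∀ v, |x v| ≤ 1) ∧ (∀ v, v ∉ U → x v = x₀ v) ∧
      (∀ i, |⟪x - x₀, a i⟫| ≤ D i)} with hP
  have hclosed : IsClosed P := by
    simp only [hP, Set.ofPred_and, Set.ofPred_forall]
    refine (isClosed_iInter fun v => isClosed_le (by fun_prop) (by fun_prop)).inter
      ((isClosed_iInter fun v => isClosed_iInter fun _ => isClosed_eq (by fun_prop)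
        (by fun_prop)).inter
      (isClosed_iInter fun i => isClosed_le (by fun_prop) (by fun_prop)))
  have hbdd : Bornology.IsBounded P := by
    rw [isBounded_iff_forall_norm_le]
    refine ⟨√(Fintype.card V), fun x hx => ?_⟩
    rw [EuclideanSpace.norm_eq]
    refine Real.sqrt_le_sqrt ?_
    calc ∑ v, ‖x v‖ ^ 2 ≤ ∑ v : V, (1 : ℝ) := Finset.sum_le_sum fun v _ => by
          rw [Real.norm_eq_abs]; exact pow_le_one₀ (abs_nonneg _) (hx.1 v)
      _ = _ := by simp
  have hcpt : IsCompact P := Metric.isCompact_of_isClosed_isBounded hclosed hbdd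
  have hx₀P : x₀ ∈ P := ⟨hx₀, fun _ _ => rfl, fun i => by simpa using (hD i).le⟩
  -- Maximizing the squares pushes coordinates towards `±1`. The quartic penalty keeps most forms
  -- away from their limits `D i`, while its Hessian, of size `b i ^ 2`, stays small on average.
  set G : EuclideanSpace ℝ V → ℝ := fun x =>
    ∑ v ∈ U, x v ^ 2 - 4 * ∑ i, (⟪x - x₀, a i⟫ / D i) ^ 4 with hG
  have hGc : Continuous G := by
    simp only [hG]
    fun_prop
  obtain ⟨x, hxP, hmax⟩ := hcpt.exists_isMaxOn ⟨x₀, hx₀P⟩ hGc.continuousOn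
  refine ⟨x, hxP.1, hxP.2.1, hxP.2.2, ?_⟩
  set b : I → ℝ := fun i => ⟪x - x₀, a i⟫ / D i with hb
  set F := U.filter fun v => |x v| < 1 with hF
  set T := Finset.univ.filter fun i => |⟪x - x₀, a i⟫| = D i with hT
  have hb4 : 4 * ∑ i, b i ^ 4 ≤ U.card := by
    have h0 : 0 ≤ G x₀ := by simp [hG, Finset.sum_nonneg, sq_nonneg]
    have h1 : G x₀ ≤ G x := hmax hx₀P
    have h2 : ∑ v ∈ U, x v ^ 2 ≤ ∑ v ∈ U, (1 : ℝ) := Finset.sum_le_sum fun v _ => by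
      rw [sq_le_one_iff_abs_le_one]; exact hxP.1 v
    simp only [Finset.sum_const, nsmul_eq_mul, mul_one] at h2
    have h3 : G x = ∑ v ∈ U, x v ^ 2 - 4 * ∑ i, b i ^ 4 := rfl
    linarith
  have hTcard : 4 * (T.card : ℝ) ≤ U.card := by
    refine le_trans ?_ hb4
    have : (T.card : ℝ) ≤ ∑ i, b i ^ 4 := by
      calc (T.card : ℝ) = ∑ i ∈ T, (1 : ℝ) := by simp
        _ = ∑ i ∈ T, b i ^ 4 := Finset.sum_congr rfl fun i hi => by
          have h1 : |b i| = 1 := by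
            rw [hb, abs_div, (Finset.mem_filter.1 hi).2, abs_of_pos (hD i), div_self (hD i).ne']
          have h2 : b i ^ 2 = 1 := by rw [← sq_abs, h1, one_pow]
          rw [show b i ^ 4 = (b i ^ 2) ^ 2 by ring, h2, one_pow]
        _ ≤ ∑ i, b i ^ 4 := Finset.sum_le_sum_of_subset_of_nonneg (Finset.subset_univ _)
          fun i _ _ => by positivity
    linarith
  -- `W` consists of the directions that move only the unfinished coordinates and leave the tight
  -- forms unchanged; along them one can move a little both ways inside `P`.
  obtain ⟨W, hW, hdim⟩ := card_le_card_add_finrank a F T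
  have hquad : ∀ v ∈ W, ‖v‖ ^ 2 ≤ ∑ i, (24 * b i ^ 2 / D i ^ 2) * ⟪v, a i⟫ ^ 2 := by
    intro v hv
    obtain ⟨hv1, hv2⟩ := hW v hv
    have hev : ∀ᶠ ε in nhds (0 : ℝ), x + ε • v ∈ P := by
      have h1 : ∀ w, ∀ᶠ ε in nhds (0 : ℝ), |(x + ε • v) w| ≤ 1 := by
        intro w
        by_cases hw : w ∈ F
        · have hc : Continuous fun ε : ℝ => |(x + ε • v) w| := by fun_prop
          have := hc.continuousAt.eventually_lt (x₀ := 0) (continuousAt_const (y := 1))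
            (by simpa using (Finset.mem_filter.1 hw).2)
          exact this.mono fun _ h => h.le
        · exact Filter.Eventually.of_forall fun ε => by simpa [hv1 w hw] using hxP.1 w
      have h2 : ∀ i, ∀ᶠ ε in nhds (0 : ℝ), |⟪x + ε • v - x₀, a i⟫| ≤ D i := by
        intro i
        by_cases hi : i ∈ T
        · refine Filter.Eventually.of_forall fun ε => ?_
          have : x + ε • v - x₀ = (x - x₀) + ε • v := by abel
          rw [this, inner_add_left, real_inner_smul_left, hv2 i hi, mul_zero, add_zero]
          exact hxP.2.2 i
        · have hc : Continuous fun ε : ℝ => |⟪x + ε • v - x₀, a i⟫| := by fun_prop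
          have := hc.continuousAt.eventually_lt (x₀ := 0) (continuousAt_const (y := D i)) (by
            have h3 : |⟪x - x₀, a i⟫| ≠ D i := fun h => hi (by simp [hT, h])
            simpa using lt_of_le_of_ne (hxP.2.2 i) h3)
          exact this.mono fun _ h => h.le
      filter_upwards [Filter.eventually_all.2 h1, Filter.eventually_all.2 h2] with ε k1 k2
      refine ⟨k1, fun w hw => ?_, k2⟩
      have : w ∉ F := fun h => hw (Finset.mem_filter.1 h).1
      simp [hv1 w this, hxP.2.1 w hw]
    have hev' : ∀ᶠ ε in nhds (0 : ℝ), x + (-ε) • v ∈ P := by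
      have : Filter.Tendsto (fun ε : ℝ => -ε) (nhds 0) (nhds 0) := by
        simpa using (continuous_neg (G := ℝ)).tendsto 0
      exact this.eventually hev
    set c : I → ℝ := fun i => ⟪v, a i⟫ / D i with hc
    have hnorm : ‖v‖ ^ 2 = ∑ w ∈ U, v w ^ 2 := by
      rw [EuclideanSpace.norm_sq_eq, ← Finset.sum_subset (Finset.subset_univ U)]
      · simp
      · intro w _ hw
        have : w ∉ F := fun h => hw (Finset.mem_filter.1 h).1
        simp [hv1 w this]
    have hGe : ∀ ε : ℝ, G (x + ε • v) =
        ∑ w ∈ U, (x w + ε * v w) ^ 2 - 4 * ∑ i, (b i + ε * c i) ^ 4 := by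
      intro ε
      simp only [hG, hb, hc]
      congr 2
      refine Finset.sum_congr rfl fun i _ => ?_
      have : x + ε • v - x₀ = (x - x₀) + ε • v := by abel
      rw [this, inner_add_left, real_inner_smul_left]
      ring
    -- In the symmetric second difference the odd-order terms cancel; maximality of `x` makes it
    -- nonpositive, and `ε → 0` gives the Hessian inequality.
    have hsym : ∀ ε : ℝ, G (x + ε • v) + G (x + (-ε) • v) - 2 * G x =
        ε ^ 2 * (2 * (∑ w ∈ U, v w ^ 2 - 24 * ∑ i, b i ^ 2 * c i ^ 2
          - 4 * ε ^ 2 * ∑ i, c i ^ 4)) := by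
      intro ε
      have h3 : G x = G (x + (0 : ℝ) • v) := by simp
      rw [h3, hGe, hGe, hGe]
      have hS : ∑ w ∈ U, (x w + ε * v w) ^ 2 + ∑ w ∈ U, (x w + -ε * v w) ^ 2
          - 2 * ∑ w ∈ U, (x w + 0 * v w) ^ 2 = 2 * ε ^ 2 * ∑ w ∈ U, v w ^ 2 := by
        rw [Finset.mul_sum, Finset.mul_sum, ← Finset.sum_add_distrib, ← Finset.sum_sub_distrib]
        exact Finset.sum_congr rfl fun w _ => by ring
      have hQ : ∑ i, (b i + ε * c i) ^ 4 + ∑ i, (b i + -ε * c i) ^ 4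
          - 2 * ∑ i, (b i + 0 * c i) ^ 4
          = 12 * ε ^ 2 * ∑ i, b i ^ 2 * c i ^ 2 + 2 * ε ^ 4 * ∑ i, c i ^ 4 := by
        rw [Finset.mul_sum, Finset.mul_sum, Finset.mul_sum, ← Finset.sum_add_distrib,
          ← Finset.sum_sub_distrib, ← Finset.sum_add_distrib]
        exact Finset.sum_congr rfl fun w _ => by ring
      linear_combination hS - 4 * hQ
    have hlim : ∀ᶠ ε in nhdsWithin (0 : ℝ) {0}ᶜ,
        ∑ w ∈ U, v w ^ 2 - 24 * ∑ i, b i ^ 2 * c i ^ 2 - 4 * ε ^ 2 * ∑ i, c i ^ 4 ≤ 0 := by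
      filter_upwards [hev.filter_mono nhdsWithin_le_nhds, hev'.filter_mono nhdsWithin_le_nhds,
        self_mem_nhdsWithin] with ε k1 k2 k3
      have h4 := hmax k1
      have h5 := hmax k2
      have h6 := hsym ε
      have h7 : 0 < ε ^ 2 := by
        have : ε ≠ 0 := k3
        positivity
      simp only [Set.mem_ofPred_eq] at h4 h5
      by_contra! hcon
      have := mul_pos h7 (mul_pos two_pos hcon)
      linarith
    have hcont : Continuous fun ε : ℝ => ∑ w ∈ U, v w ^ 2 - 24 * ∑ i, b i ^ 2 * c i ^ 2
        - 4 * ε ^ 2 * ∑ i, c i ^ 4 := by fun_prop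
    have h8 := le_of_tendsto ((hcont.tendsto 0).mono_left nhdsWithin_le_nhds) hlim
    have h9 : ∑ i, (24 * b i ^ 2 / D i ^ 2) * ⟪v, a i⟫ ^ 2 = 24 * ∑ i, b i ^ 2 * c i ^ 2 := by
      rw [Finset.mul_sum]
      refine Finset.sum_congr rfl fun i _ => ?_
      simp only [hc]
      ring
    rw [hnorm, h9]
    simp only [ne_eq, OfNat.ofNat_ne_zero, not_false_eq_true, zero_pow, mul_zero, zero_mul,
      sub_zero] at h8
    linarith
  have hrank := finrank_le_of_norm_sq_le_sum a (fun i => 24 * b i ^ 2 / D i ^ 2)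
    (fun i => by positivity) W hquad
  -- The constant `2304` is chosen so that `4 * 2304 = 96 ^ 2` and `24 / 96 = 1 / 4`: then `W` and
  -- `T` each account for at most a quarter of `U`.
  have hcs : (∑ i, b i ^ 2 * (L i / D i ^ 2)) ^ 2 ≤ ((U.card : ℝ) / 96) ^ 2 := by
    calc (∑ i, b i ^ 2 * (L i / D i ^ 2)) ^ 2
        ≤ (∑ i, (b i ^ 2) ^ 2) * ∑ i, (L i / D i ^ 2) ^ 2 :=
          Finset.sum_mul_sq_le_sq_mul_sq _ _ _
      _ = (∑ i, b i ^ 4) * ∑ i, L i ^ 2 / D i ^ 4 := by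
          congr 1 <;> refine Finset.sum_congr rfl fun i _ => ?_
          · ring
          · rw [div_pow]; ring
      _ ≤ (U.card / 4) * (U.card / 2304) := by
          refine mul_le_mul (by linarith) hsum (Finset.sum_nonneg fun i _ => by positivity)
            (by positivity)
      _ = _ := by ring
  have hcs' := abs_le_of_sq_le_sq' hcs (by positivity)
  have hrank' : (Module.finrank ℝ W : ℝ) ≤ U.card / 4 := by
    calc (Module.finrank ℝ W : ℝ) ≤ ∑ i, (24 * b i ^ 2 / D i ^ 2) * ‖a i‖ ^ 2 := hrank
      _ ≤ ∑ i, (24 * b i ^ 2 / D i ^ 2) * L i :=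
          Finset.sum_le_sum fun i _ => mul_le_mul_of_nonneg_left (hL i) (by positivity)
      _ = 24 * ∑ i, b i ^ 2 * (L i / D i ^ 2) := by
          rw [Finset.mul_sum]
          exact Finset.sum_congr rfl fun i _ => by ring
      _ ≤ 24 * (U.card / 96) := by linarith [hcs'.2]
      _ = _ := by ring
  have hdim' : (F.card : ℝ) ≤ T.card + Module.finrank ℝ W := by exact_mod_cast hdim
  have : (2 : ℝ) * F.card ≤ U.card := by linarith
  exact_mod_cast this

/-! ### Colorings with small prefix sums along many sequences. -/

/-- Clear the binary digits of `m` from the lowest upwards; each digit `1` at position `i` costs one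
dyadic block of length `2 ^ i`. -/
theorem abs_sub_le_sum_dyadic (F : ℕ → ℝ) (δ : ℕ → ℝ) (hδ : ∀ i, 0 ≤ δ i) (W : ℕ)
    (hF : ∀ i q, (q + 1) * 2 ^ i ≤ W → |F ((q + 1) * 2 ^ i) - F (q * 2 ^ i)| ≤ δ i)
    (m : ℕ) (hm : m ≤ W) (k : ℕ) :
    |F m - F (m / 2 ^ k * 2 ^ k)| ≤ ∑ i ∈ Finset.range k, δ i := by
  induction k with
  | zero => simp
  | succ k ih =>
    rw [Finset.sum_range_succ]
    have hq : m / 2 ^ (k + 1) = m / 2 ^ k / 2 := by rw [pow_succ, Nat.div_div_eq_div_mul]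
    set q := m / 2 ^ k with hqdef
    rcases Nat.even_or_odd' q with ⟨b, hb | hb⟩
    · have : m / 2 ^ (k + 1) * 2 ^ (k + 1) = q * 2 ^ k := by
        rw [hq, hb, Nat.mul_div_cancel_left _ two_pos, pow_succ]; ring
      rw [this]
      linarith [hδ k]
    · have h1 : m / 2 ^ (k + 1) * 2 ^ (k + 1) = (2 * b) * 2 ^ k := by
        rw [hq, hb, show (2 * b + 1) / 2 = b by omega, pow_succ]; ring
      have h2 : (2 * b + 1) * 2 ^ k ≤ W := by
        rw [← hb]; exact (Nat.div_mul_le_self m (2 ^ k)).trans hm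
      have h3 := hF k (2 * b) h2
      rw [h1]
      rw [hb] at ih
      calc |F m - F (2 * b * 2 ^ k)|
          = |(F m - F ((2 * b + 1) * 2 ^ k)) + (F ((2 * b + 1) * 2 ^ k) - F (2 * b * 2 ^ k))| := by
            ring_nf
        _ ≤ _ := (abs_add_le _ _).trans (add_le_add ih h3)

theorem sum_pow_mul_pow_le (x y : ℝ) (hy : 0 ≤ y) (hxy : y < x) (k : ℕ) :
    ∑ i ∈ Finset.range (k + 1), x ^ i * y ^ (k - i) ≤ x / (x - y) * x ^ k := by
  have h := (Commute.all x y).geom_sum₂_mul (k + 1)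
  have h0 : 0 < x - y := sub_pos.2 hxy
  rw [div_mul_eq_mul_div, le_div_iff₀ h0]
  simp only [Nat.add_sub_cancel] at h
  rw [h, pow_succ' x]
  linarith [pow_nonneg hy (k + 1)]

theorem sum_sq_fiber_sum_le {V : Type*} [Fintype V] [DecidableEq V] (B : Finset ℕ) (u : ℕ → V)
    (s : ℕ → ℝ) (hs : ∀ t, |s t| ≤ 1) (g : ℕ)
    (hg : ∀ v, (B.filter fun t => u t = v).card ≤ g) :
    ∑ v, (∑ t ∈ B.filter fun t => u t = v, s t) ^ 2 ≤ g * B.card := by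
  have h1 : ∀ v, (∑ t ∈ B.filter fun t => u t = v, s t) ^ 2
      ≤ g * ((B.filter fun t => u t = v).card : ℝ) := by
    intro v
    have h2 : |∑ t ∈ B.filter fun t => u t = v, s t| ≤ (B.filter fun t => u t = v).card := by
      refine (Finset.abs_sum_le_sum_abs _ _).trans ?_
      refine (Finset.sum_le_sum fun t _ => hs t).trans ?_
      simp
    have h3 : ((B.filter fun t => u t = v).card : ℝ) ≤ g := by exact_mod_cast hg v
    rw [← sq_abs, sq]
    exact mul_le_mul (h2.trans h3) h2 (abs_nonneg _) (by positivity)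
  refine (Finset.sum_le_sum fun v _ => h1 v).trans ?_
  rw [← Finset.mul_sum]
  have : ∑ v, ((B.filter fun t => u t = v).card : ℝ) = B.card := by
    rw [Finset.card_eq_sum_card_fiberwise (f := u) (t := Finset.univ) (fun _ _ => by simp)]
    push_cast
    rfl
  rw [this]

open scoped RealInnerProductSpace in
theorem inner_fiber_sum {V : Type*} [Fintype V] [DecidableEq V] (B : Finset ℕ) (u : ℕ → V)
    (s : ℕ → ℝ) (y : EuclideanSpace ℝ V) :
    ⟪y, WithLp.toLp 2 fun v => ∑ t ∈ B.filter fun t => u t = v, s t⟫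
      = ∑ t ∈ B, s t * y (u t) := by
  rw [PiLp.inner_apply, ← Finset.sum_fiberwise_of_maps_to (s := B) (t := Finset.univ) (g := u)
    (fun _ _ => Finset.mem_univ _)]
  refine Finset.sum_congr rfl fun v _ => ?_
  simp only [RCLike.inner_apply, conj_trivial, Finset.sum_mul]
  refine Finset.sum_congr rfl fun t ht => ?_
  rw [(Finset.mem_filter.1 ht).2]

/-- The positions `t < n` of the live terms of the sequence `u` whose rank among the live terms
lies in `[a, b)`. -/
def liveBlock {V : Type*} [DecidableEq V] (U : Finset V) (u : ℕ → V) (n a b : ℕ) : Finset ℕ :=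
  (Finset.range n).filter fun t => u t ∈ U ∧ Nat.count (fun t => u t ∈ U) t ∈ Finset.Ico a b

theorem card_liveBlock_le {V : Type*} [DecidableEq V] (U : Finset V) (u : ℕ → V) (n a b : ℕ) :
    (liveBlock U u n a b).card ≤ b - a := by
  rw [← Nat.card_Ico]
  refine Finset.card_le_card_of_injOn (Nat.count fun t => u t ∈ U)
    (fun t ht => (Finset.mem_filter.1 ht).2.2) fun t ht t' ht' h => ?_
  exact Nat.count_injective (Finset.mem_filter.1 ht).2.1 (Finset.mem_filter.1 ht').2.1 h

theorem sum_liveBlock_sub {V : Type*} [DecidableEq V] (U : Finset V) (u : ℕ → V) (n a b : ℕ)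
    (hab : a ≤ b) (f : ℕ → ℝ) :
    ∑ t ∈ liveBlock U u n 0 b, f t - ∑ t ∈ liveBlock U u n 0 a, f t
      = ∑ t ∈ liveBlock U u n a b, f t := by
  have hsub : liveBlock U u n 0 a ⊆ liveBlock U u n 0 b := by
    intro t ht
    simp only [liveBlock, Finset.mem_filter, Finset.mem_Ico] at ht ⊢
    exact ⟨ht.1, ht.2.1, by omega⟩
  rw [sub_eq_iff_eq_add, ← Finset.sum_sdiff hsub]
  congr 2
  ext t
  simp only [liveBlock, Finset.mem_filter, Finset.mem_Ico, Finset.mem_sdiff]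
  constructor
  · rintro ⟨⟨h1, h2, h3⟩, h4⟩
    refine ⟨h1, h2, ?_, h3.2⟩
    by_contra h5
    exact h4 ⟨h1, h2, by omega, by omega⟩
  · rintro ⟨h1, h2, h3⟩
    exact ⟨⟨h1, h2, by omega, h3.2⟩, fun h => by omega⟩

/-- Dead variables do not move, so only live terms matter. Measuring prefixes by live rank makes the
number of dyadic blocks depend on `U.card` rather than on `n`, so that the error shrinks as the
coloring progresses. -/
theorem sum_range_eq_sum_liveBlock {V : Type*} [DecidableEq V] (U : Finset V) (u : ℕ → V)
    (n T : ℕ) (hT : T ≤ n) (f : ℕ → ℝ) (hf : ∀ t, u t ∉ U → f t = 0) :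
    ∑ t ∈ Finset.range T, f t
      = ∑ t ∈ liveBlock U u n 0 (Nat.count (fun t => u t ∈ U) T), f t := by
  symm
  refine Finset.sum_subset_zero_on_sdiff ?_ ?_ fun _ _ => rfl
  · intro t ht
    simp only [liveBlock, Finset.mem_filter, Finset.mem_Ico] at ht
    rw [Finset.mem_range]
    exact Nat.lt_of_count_lt_count ht.2.2.2
  · intro t ht
    simp only [liveBlock, Finset.mem_filter, Finset.mem_Ico, Finset.mem_sdiff,
      Finset.mem_range] at ht
    refine hf t fun h => ht.2 ⟨by omega, h, by omega, ?_⟩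
    exact Nat.count_strict_mono h ht.1

theorem count_live_le {V : Type*} [DecidableEq V] (U : Finset V) (u : ℕ → V) (n T g : ℕ)
    (hT : T ≤ n) (hg : ∀ v, ((Finset.range n).filter fun t => u t = v).card ≤ g) :
    Nat.count (fun t => u t ∈ U) T ≤ g * U.card := by
  refine (Nat.count_monotone _ hT).trans ?_
  rw [Nat.count_eq_card_filter_range]
  have hmaps : Set.MapsTo u ((Finset.range n).filter fun t => u t ∈ U) U :=
    fun t ht => (Finset.mem_filter.1 ht).2
  rw [Finset.card_eq_sum_card_fiberwise hmaps, mul_comm, ← smul_eq_mul]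
  refine Finset.sum_le_card_nsmul _ _ _ fun v _ => ?_
  refine (Finset.card_le_card fun t ht => ?_).trans (hg v)
  simp only [Finset.mem_filter] at ht ⊢
  exact ⟨ht.1.1, ht.2⟩

/-- Scale `i` has `R * (W / 2 ^ i)` blocks of squared norm at most `g * 2 ^ i`, with tolerances
decreasing by `9 / 10` per step below the top scale. Since `(10 / 9) ^ 4 < 2`, the sum is geometric
and dominated by the top scale, while the tolerances themselves remain summable. -/
theorem sum_block_weights_le (R g M B : ℝ) (W : ℕ) (hW : W ≠ 0) (hR : 0 < R) (hg : 0 < g)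
    (hM : 0 < M) (hWM : (W : ℝ) = g * M) (hB : B ^ 4 = 10000 * g ^ 4 * (R * M)) :
    ∑ i ∈ Finset.range (Nat.log 2 W + 1), R * (((W / 2 ^ i : ℕ) : ℝ) *
      ((g * 2 ^ i) ^ 2 / (B * (9 / 10) ^ (Nat.log 2 W - i)) ^ 4)) ≤ M / 2304 := by
  set k := Nat.log 2 W
  have hk : (2 : ℝ) ^ k ≤ W := by exact_mod_cast Nat.pow_log_le_self 2 hW
  have hterm : ∀ i ∈ Finset.range (k + 1), R * (((W / 2 ^ i : ℕ) : ℝ) *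
      ((g * 2 ^ i) ^ 2 / (B * (9 / 10) ^ (k - i)) ^ 4))
      ≤ R * W * g ^ 2 / B ^ 4 * (2 ^ i * ((10 / 9) ^ 4) ^ (k - i)) := by
    intro i _
    have h1 : ((W / 2 ^ i : ℕ) : ℝ) ≤ W / 2 ^ i := by
      have := @Nat.cast_div_le ℝ _ _ _ W (2 ^ i)
      simpa using this
    have h2 : (0 : ℝ) ≤ (g * 2 ^ i) ^ 2 / (B * (9 / 10) ^ (k - i)) ^ 4 := by positivity
    calc R * (((W / 2 ^ i : ℕ) : ℝ) * ((g * 2 ^ i) ^ 2 / (B * (9 / 10) ^ (k - i)) ^ 4))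
        ≤ R * (W / 2 ^ i * ((g * 2 ^ i) ^ 2 / (B * (9 / 10) ^ (k - i)) ^ 4)) := by gcongr
      _ = R * W * g ^ 2 / B ^ 4 * (2 ^ i * ((10 / 9) ^ 4) ^ (k - i)) := by
          rw [show (10 / 9 : ℝ) = (9 / 10)⁻¹ by norm_num, inv_pow, inv_pow, ← pow_mul,
            mul_comm 4, pow_mul]
          field_simp
  refine (Finset.sum_le_sum hterm).trans ?_
  rw [← Finset.mul_sum]
  have hgeo := sum_pow_mul_pow_le 2 ((10 / 9) ^ 4) (by norm_num) (by norm_num) k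
  have h3 : R * W * g ^ 2 / B ^ 4 = 1 / (10000 * g) := by
    rw [hB, hWM]
    field_simp
  rw [h3]
  have hgM : (2 : ℝ) ^ k ≤ g * M := hWM ▸ hk
  have h4 : (∑ i ∈ Finset.range (k + 1), (2 : ℝ) ^ i * ((10 / 9) ^ 4) ^ (k - i))
      ≤ 421 / 100 * (g * M) := by
    refine hgeo.trans ?_
    refine mul_le_mul (by norm_num) hgM (by positivity) (by norm_num)
  calc 1 / (10000 * g) * _ ≤ 1 / (10000 * g) * (421 / 100 * (g * M)) := by gcongr
    _ = 421 / 1000000 * M := by field_simp; norm_num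
    _ ≤ M / 2304 := by linarith

open scoped RealInnerProductSpace in
theorem exists_partial_coloring_of_sequences {V J : Type*} [Fintype V] [DecidableEq V] [Fintype J]
    [Nonempty J] (u : J → ℕ → V) (s : J → ℕ → ℝ) (hs : ∀ j t, |s j t| ≤ 1) (n g : ℕ) (hg0 : 0 < g)
    (hg : ∀ j v, ((Finset.range n).filter fun t => u j t = v).card ≤ g)
    (U : Finset V) (hU : U.Nonempty) (x₀ : EuclideanSpace ℝ V) (hx₀ : ∀ v, |x₀ v| ≤ 1) :
    ∃ x : EuclideanSpace ℝ V, (∀ v, |x v| ≤ 1) ∧ (∀ v ∉ U, x v = x₀ v) ∧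
      (∀ j, ∀ T ≤ n, |∑ t ∈ Finset.range T, s j t * (x - x₀) (u j t)|
        ≤ 100 * g * ((Fintype.card J : ℝ) * U.card) ^ (1 / 4 : ℝ)) ∧
      2 * (U.filter fun v => |x v| < 1).card ≤ U.card := by
  classical
  set W := g * U.card with hW
  have hUpos : 0 < U.card := hU.card_pos
  have hW0 : W ≠ 0 := by positivity
  set k := Nat.log 2 W with hk
  set ρ := ((Fintype.card J : ℝ) * U.card) ^ (1 / 4 : ℝ) with hρ
  have hJ : (0 : ℝ) < Fintype.card J := by exact_mod_cast Fintype.card_pos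
  have hρ4 : ρ ^ 4 = (Fintype.card J : ℝ) * U.card := by
    rw [hρ, ← Real.rpow_natCast, ← Real.rpow_mul (by positivity)]
    norm_num
  have hρ0 : 0 < ρ := by positivity
  set B : ℝ := 10 * g * ρ with hB
  have hB0 : 0 < B := by positivity
  have hB4 : B ^ 4 = 10000 * (g : ℝ) ^ 4 * ((Fintype.card J : ℝ) * U.card) := by
    rw [hB, mul_pow, hρ4]; ring
  let blk : J × (Σ i : Fin (k + 1), Fin (W / 2 ^ (i : ℕ))) → Finset ℕ := fun p =>
    liveBlock U (u p.1) n (p.2.2 * 2 ^ (p.2.1 : ℕ)) ((p.2.2 + 1) * 2 ^ (p.2.1 : ℕ))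
  obtain ⟨x, hx1, hx2, hx3, hx4⟩ := exists_partial_coloring U
    (fun p => WithLp.toLp 2 fun v => ∑ t ∈ (blk p).filter fun t => u p.1 t = v, s p.1 t)
    (fun p => g * 2 ^ (p.2.1 : ℕ)) (fun p => B * (9 / 10) ^ (k - p.2.1)) (fun p => by positivity)
    (fun p => by
      rw [EuclideanSpace.norm_sq_eq]
      simp only [Real.norm_eq_abs, sq_abs]
      refine (sum_sq_fiber_sum_le (blk p) (u p.1) (s p.1) (hs p.1) g fun v => ?_).trans ?_
      · refine (Finset.card_le_card ?_).trans (hg p.1 v)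
        exact Finset.filter_subset_filter _ (Finset.filter_subset _ _)
      · have := card_liveBlock_le U (u p.1) n (p.2.2 * 2 ^ (p.2.1 : ℕ))
          ((p.2.2 + 1) * 2 ^ (p.2.1 : ℕ))
        rw [← Nat.sub_mul, Nat.add_sub_cancel_left, one_mul] at this
        have h2 : ((blk p).card : ℝ) ≤ 2 ^ (p.2.1 : ℕ) := by exact_mod_cast this
        gcongr)
    (by
      refine le_trans (le_of_eq ?_) (sum_block_weights_le (Fintype.card J) g U.card B W hW0 hJ
        (by positivity) (by positivity) (by rw [hW]; push_cast; rfl) hB4)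
      rw [Fintype.sum_prod_type]
      simp only [Fintype.sum_sigma, Finset.sum_const, Finset.card_univ, Fintype.card_fin,
        nsmul_eq_mul]
      rw [Finset.mul_sum, ← Fin.sum_univ_eq_sum_range
        (fun i => (Fintype.card J : ℝ) * (((W / 2 ^ i : ℕ) : ℝ) *
          ((g * 2 ^ i) ^ 2 / (B * (9 / 10) ^ (k - i)) ^ 4)))])
    x₀ hx₀
  refine ⟨x, hx1, hx2, fun j T hT => ?_, hx4⟩
  set F : ℕ → ℝ := fun m => ∑ t ∈ liveBlock U (u j) n 0 m, s j t * (x - x₀) (u j t) with hF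
  rw [sum_range_eq_sum_liveBlock U (u j) n T hT _ fun t ht => by simp [hx2 _ ht]]
  have hcW : Nat.count (fun t => u j t ∈ U) T ≤ W := count_live_le U (u j) n T g hT (hg j)
  have hdy := abs_sub_le_sum_dyadic F (fun i => B * (9 / 10) ^ (k - i)) (fun i => by positivity) W
    (fun i q hq => by
      have hlt : 2 ^ i ≤ W := le_trans (Nat.le_mul_of_pos_left _ (Nat.succ_pos q)) hq
      have hik : i < k + 1 := Nat.lt_succ_of_le (Nat.le_log_of_pow_le one_lt_two hlt)
      have hqW : q < W / 2 ^ i := by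
        rw [← Nat.succ_le_iff, Nat.le_div_iff_mul_le (by positivity)]
        exact hq
      have h := hx3 (j, ⟨⟨i, hik⟩, ⟨q, hqW⟩⟩)
      rw [inner_fiber_sum] at h
      simp only [hF]
      rw [sum_liveBlock_sub _ _ _ _ _ (Nat.mul_le_mul_right _ (Nat.le_succ q))]
      exact h)
    _ hcW (k + 1)
  have hdiv : Nat.count (fun t => u j t ∈ U) T / 2 ^ (k + 1) = 0 :=
    Nat.div_eq_of_lt (hcW.trans_lt (Nat.lt_pow_succ_log_self one_lt_two W))
  rw [hdiv, zero_mul] at hdy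
  have hF0 : F 0 = 0 := by simp [hF, liveBlock]
  rw [hF0, sub_zero] at hdy
  refine hdy.trans ?_
  have hgeo := sum_pow_mul_pow_le 1 (9 / 10) (by norm_num) (by norm_num) k
  simp only [one_pow, one_mul, mul_one] at hgeo
  rw [← Finset.mul_sum]
  -- The tolerances add up to at most `10 * B`, and `B = 10 * g * ρ`.
  calc B * _ ≤ B * (1 / (1 - 9 / 10)) := by gcongr
    _ = 100 * g * ρ := by rw [hB]; ring

/-- Iterate partial coloring. The live set at least halves each time, so the errors, proportional to
its size to the power `1/4`, form a convergent geometric series. -/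
theorem exists_coloring_of_sequences_aux {V J : Type*} [Fintype V] [DecidableEq V] [Fintype J]
    [Nonempty J] (u : J → ℕ → V) (s : J → ℕ → ℝ) (hs : ∀ j t, |s j t| ≤ 1) (n g : ℕ) (hg0 : 0 < g)
    (hg : ∀ j v, ((Finset.range n).filter fun t => u j t = v).card ≤ g) (N : ℕ) :
    ∀ (U : Finset V) (x₀ : EuclideanSpace ℝ V), U.card ≤ N → (∀ v, |x₀ v| ≤ 1) →
      (∀ v ∉ U, |x₀ v| = 1) →
    ∃ x : EuclideanSpace ℝ V, (∀ v, |x v| = 1) ∧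
      ∀ j, ∀ T ≤ n, |∑ t ∈ Finset.range T, s j t * (x - x₀) (u j t)|
        ≤ 640 * g * ((Fintype.card J : ℝ) * U.card) ^ (1 / 4 : ℝ) := by
  induction N with
  | zero =>
    intro U x₀ hN h1 h2
    have hU : U = ∅ := by simpa using hN
    subst hU
    exact ⟨x₀, fun v => h2 v (by simp), fun j T _ => by simp⟩
  | succ N ih =>
    intro U x₀ hN h1 h2
    rcases U.eq_empty_or_nonempty with rfl | hU
    · exact ⟨x₀, fun v => h2 v (by simp), fun j T _ => by simp⟩
    obtain ⟨x₁, k1, k2, k3, k4⟩ :=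
      exists_partial_coloring_of_sequences u s hs n g hg0 hg U hU x₀ h1
    set U' := U.filter fun v => |x₁ v| < 1
    have hUpos : 0 < U.card := hU.card_pos
    obtain ⟨x, l1, l2⟩ := ih U' x₁ (by omega) k1 fun v hv => by
      by_cases hvU : v ∈ U
      · refine le_antisymm (k1 v) ?_
        by_contra! hlt
        exact hv (Finset.mem_filter.2 ⟨hvU, hlt⟩)
      · rw [k2 v hvU]; exact h2 v hvU
    refine ⟨x, l1, fun j T hT => ?_⟩
    set ρ := ((Fintype.card J : ℝ) * U.card) ^ (1 / 4 : ℝ) with hρ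
    have hρ0 : 0 ≤ ρ := by positivity
    -- `0.841 ^ 4` slightly exceeds `1 / 2`, and `640 * 0.841 + 100 ≤ 640` closes the induction.
    have hhalf : ((Fintype.card J : ℝ) * U'.card) ^ (1 / 4 : ℝ) ≤ 841 / 1000 * ρ := by
      have h5 : (2 : ℝ) * U'.card ≤ U.card := by exact_mod_cast k4
      calc ((Fintype.card J : ℝ) * U'.card) ^ (1 / 4 : ℝ)
          ≤ ((841 / 1000 : ℝ) ^ 4 * ((Fintype.card J : ℝ) * U.card)) ^ (1 / 4 : ℝ) := by
            refine Real.rpow_le_rpow (by positivity) ?_ (by norm_num)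
            have h6 : (U'.card : ℝ) ≤ (841 / 1000 : ℝ) ^ 4 * U.card := by
              have : (0 : ℝ) < U.card := by exact_mod_cast hUpos
              norm_num
              linarith
            calc (Fintype.card J : ℝ) * U'.card
                ≤ Fintype.card J * ((841 / 1000 : ℝ) ^ 4 * U.card) := by gcongr
              _ = _ := by ring
        _ = 841 / 1000 * ρ := by
            rw [Real.mul_rpow (by positivity) (by positivity), ← Real.rpow_natCast,
              ← Real.rpow_mul (by norm_num)]
            norm_num [hρ]
    have hsplit : ∑ t ∈ Finset.range T, s j t * (x - x₀) (u j t)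
        = ∑ t ∈ Finset.range T, s j t * (x - x₁) (u j t)
          + ∑ t ∈ Finset.range T, s j t * (x₁ - x₀) (u j t) := by
      rw [← Finset.sum_add_distrib]
      refine Finset.sum_congr rfl fun t _ => ?_
      simp only [PiLp.sub_apply]
      ring
    rw [hsplit]
    refine (abs_add_le _ _).trans ((add_le_add (l2 j T hT) (k3 j T hT)).trans ?_)
    have hg' : (0 : ℝ) ≤ g := by positivity
    calc 640 * g * ((Fintype.card J : ℝ) * U'.card) ^ (1 / 4 : ℝ) + 100 * g * ρ
        ≤ 640 * g * (841 / 1000 * ρ) + 100 * g * ρ := by gcongr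
      _ ≤ 640 * g * ρ := by nlinarith [mul_nonneg hg' hρ0]

/-- Given `R` sequences of length `n` over a set of variables, each variable occurring at most `g`
times in each sequence, some `±1` assignment makes all signed prefix sums
`O(g * (R * |V|) ^ (1/4))`. -/
theorem exists_coloring_of_sequences {V J : Type*} [Fintype V] [DecidableEq V] [Fintype J]
    [Nonempty J] (u : J → ℕ → V) (s : J → ℕ → ℝ) (hs : ∀ j t, |s j t| ≤ 1) (n g : ℕ) (hg0 : 0 < g)
    (hg : ∀ j v, ((Finset.range n).filter fun t => u j t = v).card ≤ g) :
    ∃ x : V → ℝ, (∀ v, |x v| = 1) ∧ ∀ j, ∀ T ≤ n, |∑ t ∈ Finset.range T, s j t * x (u j t)|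
        ≤ 640 * g * ((Fintype.card J : ℝ) * Fintype.card V) ^ (1 / 4 : ℝ) := by
  obtain ⟨x, h1, h2⟩ := exists_coloring_of_sequences_aux u s hs n g hg0 hg _ Finset.univ 0 le_rfl
    (by simp) (by simp)
  exact ⟨x, h1, fun j T hT => by simpa using h2 j T hT⟩

/-! ### Signed groupings that balance all cosets. -/

/-- A grouping `v` of `{0, …, r - 1}` into classes of size at most `g`, with signs `s`, such that
every assignment of values in `[-1, 1]` to the classes, multiplied by the signs, has sum at most `1`
in absolute value over every residue class modulo a divisor of `r`. -/
def HasBalancedGrouping (r g : ℕ) : Prop :=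
  ∃ (v : ℕ → ℕ) (s : ℕ → ℝ), (∀ t, |s t| = 1) ∧ (∀ t < r, v t < r) ∧
    (∀ w, ((Finset.range r).filter fun t => v t = w).card ≤ g) ∧
    ∀ x : ℕ → ℝ, (∀ w, |x w| ≤ 1) → ∀ d, d ∣ r → ∀ b,
      |∑ t ∈ Finset.range r, if t ≡ b [MOD d] then s t * x (v t) else 0| ≤ 1

theorem sum_range_mul_eq {M : Type*} [AddCommMonoid M] (f : ℕ → M) (m n : ℕ) :
    ∑ t ∈ Finset.range (m * n), f t
      = ∑ y ∈ Finset.range m, ∑ q ∈ Finset.range n, f (y + m * q) := by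
  rw [Finset.sum_comm]
  induction n with
  | zero => simp
  | succ n ih =>
    rw [Nat.mul_succ, Finset.sum_range_add, ih, Finset.sum_range_succ]
    simp_rw [add_comm (m * n)]

theorem abs_sum_modEq_self_le {r : ℕ} (f : ℕ → ℝ) (hf : ∀ t, |f t| ≤ 1) (b : ℕ) :
    |∑ t ∈ Finset.range r, if t ≡ b [MOD r] then f t else 0| ≤ 1 := by
  rw [← Finset.sum_filter]
  refine (Finset.abs_sum_le_sum_abs _ _).trans ((Finset.sum_le_sum fun t _ => hf t).trans ?_)
  have : ((Finset.range r).filter fun t => t ≡ b [MOD r]).card ≤ 1 := by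
    refine Finset.card_le_one.2 fun t ht t' ht' => ?_
    simp only [Finset.mem_filter, Finset.mem_range] at ht ht'
    exact (ht.2.trans ht'.2.symm).eq_of_lt_of_lt ht.1 ht'.1
  simpa using this

theorem hasBalancedGrouping_one : HasBalancedGrouping 1 1 := by
  refine ⟨fun _ => 0, fun _ => 1, by simp, by simp, fun w => ?_, fun x hx d hd b => ?_⟩
  · exact (Finset.card_filter_le _ _).trans (by simp)
  · rw [Nat.dvd_one.1 hd]
    exact abs_sum_modEq_self_le _ (fun t => by simpa using hx 0) b

theorem sum_range_antisymm (p : ℕ) (X : ℕ → ℝ) :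
    ∑ q ∈ Finset.range p, (if 2 * q + 1 < p then 1 else if 2 * q + 1 = p then 0 else -1)
      * X (min q (p - 1 - q)) = 0 := by
  set h : ℕ → ℝ := fun q => (if 2 * q + 1 < p then 1 else if 2 * q + 1 = p then 0 else -1)
      * X (min q (p - 1 - q)) with hh
  have h1 := Finset.sum_range_reflect h p
  have h2 : ∑ q ∈ Finset.range p, h (p - 1 - q) = - ∑ q ∈ Finset.range p, h q := by
    rw [← Finset.sum_neg_distrib]
    refine Finset.sum_congr rfl fun q hq => ?_
    rw [Finset.mem_range] at hq
    have h3 : min (p - 1 - q) (p - 1 - (p - 1 - q)) = min q (p - 1 - q) := by omega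
    simp only [hh, h3]
    rcases lt_trichotomy (2 * q + 1) p with h4 | h4 | h4
    · rw [if_neg (by omega), if_neg (by omega), if_pos h4]; ring
    · rw [if_neg (by omega), if_pos (by omega), if_neg (by omega), if_pos h4]; ring
    · rw [if_pos (by omega), if_neg (by omega), if_neg (by omega)]; ring
  change ∑ q ∈ Finset.range p, h q = 0
  linarith

/-- Write `t = y + P * q` with `q < p`. Layers `q` and `p - 1 - q` get common classes with opposite
signs and cancel modulo every divisor of `P`. If `p` is odd, the middle layer remains and is a copy
of the grouping for `P`. Modulo `p ^ (a + 1)` a residue class is a single element. -/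
theorem HasBalancedGrouping.prime_pow_succ {p a : ℕ} (hp : p.Prime)
    (h : HasBalancedGrouping (p ^ a) 2) : HasBalancedGrouping (p ^ (a + 1)) 2 := by
  obtain ⟨v, s, hs, hv, hfib, hbal⟩ := h
  have hP : 0 < p ^ a := pow_pos hp.pos a
  set P := p ^ a with hPdef
  rw [pow_succ, ← hPdef]
  set v' : ℕ → ℕ := fun t => if 2 * (t / P) + 1 = p then v (t % P) + P * (t / P)
    else t % P + P * min (t / P) (p - 1 - t / P) with hv'
  set s' : ℕ → ℝ := fun t => if 2 * (t / P) + 1 < p then 1 else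
    if 2 * (t / P) + 1 = p then s (t % P) else -1 with hs'
  have hbound : ∀ t, |s' t| = 1 := by
    intro t
    simp only [hs']
    split_ifs
    · simp
    · exact hs _
    · simp
  refine ⟨v', s', hbound, fun t ht => ?_, fun w => ?_, fun x hx d hd b => ?_⟩
  · have h1 : t / P < p := Nat.div_lt_of_lt_mul ht
    have h2 : t % P < P := Nat.mod_lt _ hP
    have h3 : v (t % P) < P := hv _ h2
    have key : ∀ y q, y < P → q < p → y + P * q < P * p := fun y q hy hq => by
      calc y + P * q < P + P * q := by omega
        _ = P * (q + 1) := by ring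
        _ ≤ P * p := Nat.mul_le_mul_left _ hq
    simp only [hv']
    split_ifs
    · exact key _ _ h3 h1
    · exact key _ _ h2 (by omega)
  · by_cases hw : 2 * (w / P) + 1 = p
    · refine le_trans ?_ (hfib (w % P))
      refine Finset.card_le_card_of_injOn (fun t => t % P) ?_ ?_
      · intro t ht
        simp only [Finset.coe_filter, Finset.mem_range, Set.mem_ofPred_eq, hv'] at ht ⊢
        refine ⟨Nat.mod_lt _ hP, ?_⟩
        have h2 : v (t % P) < P := hv _ (Nat.mod_lt _ hP)
        obtain ⟨ht1, ht2⟩ := ht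
        split_ifs at ht2 with h3
        · rw [← ht2, Nat.add_mul_mod_self_left, Nat.mod_eq_of_lt h2]
        · exfalso
          rw [← ht2, Nat.add_mul_div_left _ _ hP, Nat.div_eq_of_lt (Nat.mod_lt _ hP)] at hw
          have h1 : t / P < p := Nat.div_lt_of_lt_mul ht1
          omega
      · have hq : ∀ t ∈ (Finset.range (P * p)).filter (fun t => v' t = w), 2 * (t / P) + 1 = p := by
          intro t ht
          simp only [Finset.mem_filter, Finset.mem_range, hv'] at ht
          obtain ⟨ht1, ht2⟩ := ht
          by_contra h3
          rw [if_neg h3] at ht2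
          rw [← ht2, Nat.add_mul_div_left _ _ hP, Nat.div_eq_of_lt (Nat.mod_lt _ hP)] at hw
          have h1 : t / P < p := Nat.div_lt_of_lt_mul ht1
          omega
        intro t ht t' ht' htt
        have h1 := hq t ht
        have h2 := hq t' ht'
        have h3 : t / P = t' / P := by omega
        rw [← Nat.mod_add_div t P, ← Nat.mod_add_div t' P, h3]
        exact congrArg (· + P * (t' / P)) htt
    · refine le_trans (Finset.card_le_card (t := {w, w % P + P * (p - 1 - w / P)}) ?_)
        Finset.card_le_two
      intro t ht
      simp only [Finset.mem_filter, Finset.mem_range, hv'] at ht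
      obtain ⟨ht1, ht2⟩ := ht
      have h1 : t / P < p := Nat.div_lt_of_lt_mul ht1
      have h2 : t % P < P := Nat.mod_lt _ hP
      have h3 : v (t % P) < P := hv _ h2
      split_ifs at ht2 with h4
      · exfalso
        rw [← ht2, Nat.add_mul_div_left _ _ hP, Nat.div_eq_of_lt h3] at hw
        omega
      · have hwd : w / P = min (t / P) (p - 1 - t / P) := by
          rw [← ht2, Nat.add_mul_div_left _ _ hP, Nat.div_eq_of_lt h2, zero_add]
        have hwm : w % P = t % P := by
          rw [← ht2, Nat.add_mul_mod_self_left, Nat.mod_mod]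
        rw [Finset.mem_insert, Finset.mem_singleton]
        rcases le_total (t / P) (p - 1 - t / P) with h5 | h5
        · left
          rw [min_eq_left h5] at hwd
          rw [← Nat.mod_add_div w P, hwm, hwd, Nat.mod_add_div]
        · right
          rw [min_eq_right h5] at hwd
          rw [hwm, hwd, show p - 1 - (p - 1 - t / P) = t / P by omega, Nat.mod_add_div]
  · have hdp : d ∣ p ^ (a + 1) := by rwa [pow_succ]
    obtain ⟨j, hj, rfl⟩ := (Nat.dvd_prime_pow hp).1 hdp
    rcases Nat.lt_or_ge a j with hja | hja
    · have : j = a + 1 := by omega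
      subst this
      rw [pow_succ, ← hPdef]
      refine abs_sum_modEq_self_le _ (fun t => ?_) b
      rw [abs_mul, hbound, one_mul]
      exact hx _
    · have hjP : p ^ j ∣ P := pow_dvd_pow p hja
      rw [sum_range_mul_eq]
      have hmod : ∀ y q, y + P * q ≡ b [MOD p ^ j] ↔ y ≡ b [MOD p ^ j] := by
        intro y q
        have : y + P * q ≡ y + 0 [MOD p ^ j] :=
          Nat.ModEq.add_left y ((Nat.modEq_zero_iff_dvd).2 (hjP.mul_right q))
        exact ⟨fun h => this.symm.trans h, fun h => this.trans h⟩
      refine le_trans (le_of_eq ?_) (hbal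
        -- The values seen by the middle layer. For `p = 2` there is no such layer and the value is
        -- `0`, which is allowed because the balance condition admits all of `[-1, 1]`.
        (fun w => if 2 * (p / 2) + 1 = p then x (w + P * (p / 2)) else 0) ?_ (p ^ j) hjP b)
      · congr 1
        refine Finset.sum_congr rfl fun y hy => ?_
        rw [Finset.mem_range] at hy
        simp only [hmod]
        split_ifs with h1 h2
        · have hterm : ∀ q ∈ Finset.range p, s' (y + P * q) * x (v' (y + P * q)) =
              (if 2 * q + 1 < p then 1 else if 2 * q + 1 = p then 0 else -1)
                * x (y + P * min q (p - 1 - q))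
              + if q = p / 2 then s y * x (v y + P * (p / 2)) else 0 := by
            intro q hq
            rw [Finset.mem_range] at hq
            have e1 : (y + P * q) / P = q := by
              rw [Nat.add_mul_div_left _ _ hP, Nat.div_eq_of_lt hy, zero_add]
            have e2 : (y + P * q) % P = y := by
              rw [Nat.add_mul_mod_self_left, Nat.mod_eq_of_lt hy]
            simp only [hs', hv', e1, e2]
            rcases lt_trichotomy (2 * q + 1) p with h4 | h4 | h4
            · rw [if_pos h4, if_neg (by omega), if_pos h4, if_neg (by omega), add_zero]
            · have : q = p / 2 := by omega
              subst this
              simp [h4]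
            · rw [if_neg (by omega), if_neg (by omega), if_neg (by omega), if_neg (by omega),
                if_neg (by omega), if_neg (by omega), add_zero]
          rw [Finset.sum_congr rfl hterm, Finset.sum_add_distrib,
            sum_range_antisymm p fun m => x (y + P * m), zero_add, Finset.sum_ite_eq',
            if_pos (Finset.mem_range.2 (Nat.div_lt_self hp.pos one_lt_two))]
        · have hterm : ∀ q ∈ Finset.range p, s' (y + P * q) * x (v' (y + P * q)) =
              (if 2 * q + 1 < p then 1 else if 2 * q + 1 = p then 0 else -1)
                * x (y + P * min q (p - 1 - q)) := by
            intro q hq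
            have e1 : (y + P * q) / P = q := by
              rw [Nat.add_mul_div_left _ _ hP, Nat.div_eq_of_lt hy, zero_add]
            have e2 : (y + P * q) % P = y := by
              rw [Nat.add_mul_mod_self_left, Nat.mod_eq_of_lt hy]
            simp only [hs', hv', e1, e2]
            have h5 : 2 * q + 1 ≠ p := by omega
            rw [if_neg h5, if_neg h5, if_neg h5]
          rw [Finset.sum_congr rfl hterm, sum_range_antisymm p fun m => x (y + P * m), mul_zero]
        · simp
      · intro w
        split_ifs
        · exact hx _
        · simp

theorem hasBalancedGrouping_prime_pow {p : ℕ} (hp : p.Prime) (a : ℕ) :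
    HasBalancedGrouping (p ^ a) 2 := by
  induction a with
  | zero =>
    obtain ⟨v, s, h1, h2, h3, h4⟩ := hasBalancedGrouping_one
    exact ⟨v, s, h1, h2, fun w => (h3 w).trans one_le_two, h4⟩
  | succ a ih => exact ih.prime_pow_succ hp

theorem mod_prod_injOn {r₁ r₂ : ℕ} (hc : r₁.Coprime r₂) :
    Set.InjOn (fun t => (t % r₁, t % r₂)) (Finset.range (r₁ * r₂) : Set ℕ) := by
  intro t ht t' ht' h
  simp only [Finset.coe_range, Set.mem_Iio, Prod.mk.injEq] at ht ht' h
  have : t ≡ t' [MOD r₁ * r₂] := (Nat.modEq_and_modEq_iff_modEq_mul hc).1 ⟨h.1, h.2⟩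
  exact this.eq_of_lt_of_lt ht ht'

theorem sum_range_mul_of_coprime {r₁ r₂ : ℕ} (hr₁ : 0 < r₁) (hr₂ : 0 < r₂) (hc : r₁.Coprime r₂)
    (f : ℕ → ℕ → ℝ) :
    ∑ t ∈ Finset.range (r₁ * r₂), f (t % r₁) (t % r₂)
      = ∑ t₁ ∈ Finset.range r₁, ∑ t₂ ∈ Finset.range r₂, f t₁ t₂ := by
  rw [← Finset.sum_product']
  have hmaps : Set.MapsTo (fun t => (t % r₁, t % r₂)) (Finset.range (r₁ * r₂) : Set ℕ)
      (Finset.range r₁ ×ˢ Finset.range r₂ : Finset (ℕ × ℕ)) := by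
    intro t _
    simp [Nat.mod_lt _ hr₁, Nat.mod_lt _ hr₂]
  refine Finset.sum_nbij (fun t => (t % r₁, t % r₂)) hmaps (mod_prod_injOn hc) ?_ fun _ _ => rfl
  exact Finset.surjOn_of_injOn_of_card_le _ hmaps (mod_prod_injOn hc) (by simp)

/-- By the Chinese remainder theorem a residue class is a product of residue classes. The inner sum
over the second factor lies in `[-1, 1]` and so serves as an assignment for the first grouping; this
is why real values, not only signs, are admitted. -/
theorem HasBalancedGrouping.mul {r₁ r₂ g₁ g₂ : ℕ} (hr₁ : 0 < r₁) (hr₂ : 0 < r₂)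
    (hc : r₁.Coprime r₂) (h₁ : HasBalancedGrouping r₁ g₁) (h₂ : HasBalancedGrouping r₂ g₂) :
    HasBalancedGrouping (r₁ * r₂) (g₁ * g₂) := by
  obtain ⟨v₁, s₁, hs₁, hv₁, hf₁, hb₁⟩ := h₁
  obtain ⟨v₂, s₂, hs₂, hv₂, hf₂, hb₂⟩ := h₂
  refine ⟨fun t => v₁ (t % r₁) + r₁ * v₂ (t % r₂), fun t => s₁ (t % r₁) * s₂ (t % r₂),
    fun t => by rw [abs_mul, hs₁, hs₂, one_mul], fun t _ => ?_, fun w => ?_,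
    fun x hx d hd b => ?_⟩
  · have h1 := hv₁ _ (Nat.mod_lt t hr₁)
    have h2 := hv₂ _ (Nat.mod_lt t hr₂)
    calc v₁ (t % r₁) + r₁ * v₂ (t % r₂) < r₁ + r₁ * v₂ (t % r₂) := by omega
      _ = r₁ * (v₂ (t % r₂) + 1) := by ring
      _ ≤ r₁ * r₂ := Nat.mul_le_mul_left _ h2
  · refine le_trans ?_ (Nat.mul_le_mul (hf₁ (w % r₁)) (hf₂ (w / r₁)))
    rw [← Finset.card_product]
    refine Finset.card_le_card_of_injOn (fun t => (t % r₁, t % r₂)) ?_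
      ((mod_prod_injOn hc).mono fun t ht => Finset.mem_coe.2 (Finset.mem_filter.1 ht).1)
    intro t ht
    have ht2 := (Finset.mem_filter.1 ht).2
    have h1 := hv₁ _ (Nat.mod_lt t hr₁)
    simp only [Finset.coe_product, Finset.coe_filter, Finset.mem_range, Set.mem_prod,
      Set.mem_ofPred_eq]
    rw [← ht2, Nat.add_mul_mod_self_left, Nat.mod_eq_of_lt h1, Nat.add_mul_div_left _ _ hr₁,
      Nat.div_eq_of_lt h1, zero_add]
    exact ⟨⟨Nat.mod_lt t hr₁, rfl⟩, Nat.mod_lt t hr₂, rfl⟩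
  · obtain ⟨d₁, d₂, hd₁, hd₂, rfl⟩ := (Nat.dvd_mul).1 hd
    have hdc : d₁.Coprime d₂ := (hc.coprime_dvd_left hd₁).coprime_dvd_right hd₂
    have hmod : ∀ t, t ≡ b [MOD d₁ * d₂] ↔ (t % r₁ ≡ b [MOD d₁] ∧ t % r₂ ≡ b [MOD d₂]) := by
      intro t
      rw [← Nat.modEq_and_modEq_iff_modEq_mul hdc]
      have e1 : t % r₁ ≡ t [MOD d₁] := (Nat.mod_modEq t r₁).of_dvd hd₁
      have e2 : t % r₂ ≡ t [MOD d₂] := (Nat.mod_modEq t r₂).of_dvd hd₂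
      exact ⟨fun h => ⟨e1.trans h.1, e2.trans h.2⟩, fun h => ⟨e1.symm.trans h.1, e2.symm.trans h.2⟩⟩
    simp only [hmod]
    rw [sum_range_mul_of_coprime hr₁ hr₂ hc fun t₁ t₂ =>
      if t₁ ≡ b [MOD d₁] ∧ t₂ ≡ b [MOD d₂] then s₁ t₁ * s₂ t₂ * x (v₁ t₁ + r₁ * v₂ t₂) else 0]
    have hX := hb₁ (fun w => ∑ t₂ ∈ Finset.range r₂, if t₂ ≡ b [MOD d₂] then
      s₂ t₂ * x (w + r₁ * v₂ t₂) else 0) (fun w => hb₂ (fun y => x (w + r₁ * y)) (fun y => hx _)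
      d₂ hd₂ b) d₁ hd₁ b
    convert hX using 4 with t₁
    split_ifs with h1
    · rw [Finset.mul_sum]
      refine Finset.sum_congr rfl fun t₂ _ => ?_
      by_cases h2 : t₂ ≡ b [MOD d₂]
      · rw [if_pos ⟨h1, h2⟩, if_pos h2, mul_assoc]
      · rw [if_neg (fun h => h2 h.2), if_neg h2, mul_zero]
    · exact Finset.sum_eq_zero fun t₂ _ => if_neg fun h => h1 h.1

theorem hasBalancedGrouping (r : ℕ) (hr : 0 < r) : HasBalancedGrouping r (2 ^ ω r) := by
  induction r using Nat.recOnPosPrimePosCoprime with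
  | zero => exact absurd hr (lt_irrefl 0)
  | one => simpa using hasBalancedGrouping_one
  | prime_pow p n hp hn =>
    rw [ArithmeticFunction.cardDistinctFactors_apply_prime_pow hp hn.ne', pow_one]
    exact hasBalancedGrouping_prime_pow hp n
  | coprime a b ha hb hab iha ihb =>
    rw [ArithmeticFunction.cardDistinctFactors_mul hab, pow_add]
    exact (iha (by omega)).mul (by omega) (by omega) hab (ihb (by omega))

/-! ### Cycles of translations and the upper bound. -/

/-- The `t`-th term of the enumeration of `ℤ/rℤ` that lists one cycle of the translation by `d`
after another. -/
def cycleEnum (r d t : ℕ) : ℕ :=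
  (t / (r / d.gcd r) + (t % (r / d.gcd r)) * d) % r

theorem cycleEnum_lt {r : ℕ} (hr : 0 < r) (d t : ℕ) : cycleEnum r d t < r := Nat.mod_lt _ hr

theorem mul_modEq_iff_div_gcd {r : ℕ} (hr : 0 < r) (d j j' : ℕ) :
    j * d ≡ j' * d [MOD r] ↔ j ≡ j' [MOD r / d.gcd r] := by
  constructor
  · intro h
    rw [Nat.gcd_comm]
    exact Nat.ModEq.cancel_right_div_gcd hr h
  · intro h
    have h1 := Nat.ModEq.mul_right' d h
    refine h1.of_dvd ?_
    calc r = r / d.gcd r * d.gcd r := (Nat.div_mul_cancel (Nat.gcd_dvd_right d r)).symm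
      _ ∣ r / d.gcd r * d := Nat.mul_dvd_mul_left _ (Nat.gcd_dvd_left d r)

theorem div_gcd_pos {r : ℕ} (hr : 0 < r) (d : ℕ) : 0 < r / d.gcd r :=
  Nat.div_pos (Nat.le_of_dvd hr (Nat.gcd_dvd_right d r)) (Nat.gcd_pos_of_pos_right d hr)

theorem cycleEnum_modEq (r d t : ℕ) : cycleEnum r d t ≡ t / (r / d.gcd r) [MOD d.gcd r] := by
  have h1 : cycleEnum r d t ≡ t / (r / d.gcd r) + (t % (r / d.gcd r)) * d [MOD d.gcd r] :=
    (Nat.mod_modEq _ r).of_dvd (Nat.gcd_dvd_right d r)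
  refine h1.trans ?_
  have : (t % (r / d.gcd r)) * d ≡ 0 [MOD d.gcd r] :=
    Nat.modEq_zero_iff_dvd.2 ((Nat.gcd_dvd_left d r).mul_left _)
  simpa using this.add_left (t / (r / d.gcd r))

theorem div_div_gcd_lt {r : ℕ} (d : ℕ) {t : ℕ} (ht : t < r) :
    t / (r / d.gcd r) < d.gcd r := by
  refine Nat.div_lt_of_lt_mul ?_
  rwa [Nat.div_mul_cancel (Nat.gcd_dvd_right d r)]

theorem cycleEnum_injOn {r : ℕ} (hr : 0 < r) (d : ℕ) :
    Set.InjOn (cycleEnum r d) (Finset.range r : Set ℕ) := by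
  intro t ht t' ht' h
  simp only [Finset.coe_range, Set.mem_Iio] at ht ht'
  have h1 : t / (r / d.gcd r) = t' / (r / d.gcd r) := by
    refine Nat.ModEq.eq_of_lt_of_lt (m := d.gcd r) ?_ (div_div_gcd_lt d ht) (div_div_gcd_lt d ht')
    exact (cycleEnum_modEq r d t).symm.trans (h ▸ cycleEnum_modEq r d t')
  have h2 : t / (r / d.gcd r) + (t % (r / d.gcd r)) * d
      ≡ t' / (r / d.gcd r) + (t' % (r / d.gcd r)) * d [MOD r] := h
  rw [h1] at h2
  have h3 := (mul_modEq_iff_div_gcd hr d _ _).1 (Nat.ModEq.add_left_cancel' _ h2)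
  have h4 := h3.eq_of_lt_of_lt (Nat.mod_lt _ (div_gcd_pos hr d)) (Nat.mod_lt _ (div_gcd_pos hr d))
  rw [← Nat.mod_add_div t (r / d.gcd r), ← Nat.mod_add_div t' (r / d.gcd r), h1, h4]

theorem exists_cycleEnum_eq {r : ℕ} (hr : 0 < r) (d : ℕ) {a : ℕ} (ha : a < r) :
    ∃ t < r, cycleEnum r d t = a := by
  have := Finset.surjOn_of_injOn_of_card_le (cycleEnum r d)
    (s := Finset.range r) (t := Finset.range r)
    (fun t _ => by simpa using cycleEnum_lt hr d t) (cycleEnum_injOn hr d) le_rfl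
  obtain ⟨t, ht, h⟩ := this (by simpa using ha)
  exact ⟨t, by simpa using ht, h⟩

theorem sum_cycle_eq_sum_modEq {r : ℕ} (hr : 0 < r) (d : ℕ) {i : ℕ} (hi : i < d.gcd r)
    (f : ℕ → ℝ) :
    ∑ j ∈ Finset.range (r / d.gcd r), f ((i + j * d) % r)
      = ∑ t ∈ Finset.range r, if t ≡ i [MOD d.gcd r] then f t else 0 := by
  rw [← Finset.sum_filter]
  refine Finset.sum_nbij (fun j => (i + j * d) % r) ?_ ?_ ?_ fun _ _ => rfl
  · intro j _
    simp only [Finset.mem_filter, Finset.mem_range]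
    refine ⟨Nat.mod_lt _ hr, ((Nat.mod_modEq _ r).of_dvd (Nat.gcd_dvd_right d r)).trans ?_⟩
    have : j * d ≡ 0 [MOD d.gcd r] :=
      Nat.modEq_zero_iff_dvd.2 ((Nat.gcd_dvd_left d r).mul_left _)
    simpa using this.add_left i
  · intro j hj j' hj' h
    simp only [Finset.coe_range, Set.mem_Iio] at hj hj'
    have h2 : i + j * d ≡ i + j' * d [MOD r] := h
    exact ((mul_modEq_iff_div_gcd hr d _ _).1
      (Nat.ModEq.add_left_cancel' _ h2)).eq_of_lt_of_lt hj hj'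
  · intro t ht
    simp only [Finset.coe_filter, Finset.mem_range, Set.mem_ofPred_eq] at ht
    obtain ⟨t₀, ht₀, rfl⟩ := exists_cycleEnum_eq hr d ht.1
    have h1 : t₀ / (r / d.gcd r) = i :=
      ((cycleEnum_modEq r d t₀).symm.trans ht.2).eq_of_lt_of_lt (div_div_gcd_lt d ht₀) hi
    refine ⟨t₀ % (r / d.gcd r), by simpa using Nat.mod_lt _ (div_gcd_pos hr d), ?_⟩
    simp only [cycleEnum, h1]

/-- The variables are the classes of a balanced grouping and the sequences are the `r` cycle
enumerations. Coset balance holds for every choice of class values, so that choice is free to serve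
the prefix sums. -/
theorem exists_balanced_coloring (r : ℕ) (hr : 0 < r) :
    ∃ f : ℕ → ℝ, (∀ t, |f t| = 1) ∧
      (∀ d, d ∣ r → ∀ b, |∑ t ∈ Finset.range r, if t ≡ b [MOD d] then f t else 0| ≤ 1) ∧
      ∀ d < r, ∀ T ≤ r, |∑ t ∈ Finset.range T, f (cycleEnum r d t)| ≤ 640 * 2 ^ ω r * √r := by
  obtain ⟨v, s, hs, hv, hfib, hbal⟩ := hasBalancedGrouping r hr
  have : Nonempty (Fin r) := ⟨⟨0, hr⟩⟩
  obtain ⟨x, hx1, hx2⟩ := exists_coloring_of_sequences (V := Fin r) (J := Fin r)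
    (fun d t => ⟨v (cycleEnum r d t), hv _ (cycleEnum_lt hr d t)⟩)
    (fun d t => s (cycleEnum r d t)) (fun d t => (hs _).le) r (2 ^ ω r) (by positivity)
    (fun d w => by
      refine le_trans ?_ (hfib w)
      refine Finset.card_le_card_of_injOn (cycleEnum r d) ?_
        ((cycleEnum_injOn hr d).mono fun t ht => Finset.mem_coe.2 (Finset.mem_filter.1 ht).1)
      intro t ht
      have := (Finset.mem_filter.1 ht).2
      simp only [Finset.coe_filter, Finset.mem_range, Set.mem_ofPred_eq]
      exact ⟨cycleEnum_lt hr d t, congrArg Fin.val this⟩)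
  set X : ℕ → ℝ := fun w => if h : w < r then x ⟨w, h⟩ else 1 with hX
  have hX1 : ∀ w, |X w| = 1 := by
    intro w
    simp only [hX]
    split_ifs
    · exact hx1 _
    · simp
  refine ⟨fun t => s t * X (v t), fun t => by rw [abs_mul, hs, hX1, one_mul],
    hbal X fun w => (hX1 w).le, fun d hd T hT => ?_⟩
  have h := hx2 ⟨d, hd⟩ T hT
  have hsq : ((Fintype.card (Fin r) : ℝ) * Fintype.card (Fin r)) ^ (1 / 4 : ℝ) = √r := by
    rw [Fintype.card_fin, ← sq, ← Real.rpow_natCast, ← Real.rpow_mul (by positivity),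
      Real.sqrt_eq_rpow]
    norm_num
  rw [hsq] at h
  refine le_trans (le_of_eq ?_) (h.trans (by push_cast; rfl))
  congr 1
  refine Finset.sum_congr rfl fun t _ => ?_
  simp only [hX, dif_pos (hv _ (cycleEnum_lt hr d t))]

theorem sum_range_periodic (h : ℕ → ℝ) (m : ℕ) (hper : ∀ j, h (j + m) = h j) (q J : ℕ) :
    ∑ j ∈ Finset.range (m * q + J), h j
      = q * ∑ j ∈ Finset.range m, h j + ∑ j ∈ Finset.range J, h j := by
  have hper' : ∀ q j, h (m * q + j) = h j := by
    intro q j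
    induction q with
    | zero => simp
    | succ q ih => rw [← ih, ← hper (m * q + j)]; congr 1; ring
  rw [Finset.sum_range_add, sum_range_mul_eq, Finset.sum_comm]
  congr 1
  · simp_rw [add_comm _ (m * _), hper']
    simp
  · simp_rw [hper']

/-- Progressions modulo `r` are nearly balanced under a coloring that is balanced on cosets and on
the prefixes of all cycle enumerations. -/
theorem abs_sum_progression_le {r : ℕ} (hr : 0 < r) (f : ℕ → ℝ) (C : ℝ) (d : ℕ)
    (hcoset : ∀ b, |∑ t ∈ Finset.range r, if t ≡ b [MOD d.gcd r] then f t else 0| ≤ 1)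
    (hpre : ∀ T ≤ r, |∑ t ∈ Finset.range T, f (cycleEnum r d t)| ≤ C) (a l : ℕ) :
    |∑ k ∈ Finset.range l, f ((a + k * d) % r)| ≤ (l : ℝ) / (r / d.gcd r : ℕ) + 1 + 4 * C := by
  set m := r / d.gcd r with hm
  have hm0 : 0 < m := div_gcd_pos hr d
  obtain ⟨t₀, ht₀, hta⟩ := exists_cycleEnum_eq hr d (Nat.mod_lt a hr)
  set i := t₀ / m with hi
  set k₀ := t₀ % m with hk₀
  have hig : i < d.gcd r := div_div_gcd_lt d ht₀
  have hk₀m : k₀ < m := Nat.mod_lt _ hm0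
  set h : ℕ → ℝ := fun j => f ((i + j * d) % r) with hh
  have hmd : m * d ≡ 0 [MOD r] := by
    have := (mul_modEq_iff_div_gcd hr d m 0).2 (by rw [← hm]; simp [Nat.ModEq])
    simpa using this
  have hper : ∀ j, h (j + m) = h j := by
    intro j
    simp only [hh]
    congr 1
    have : i + (j + m) * d = i + j * d + m * d := by ring
    rw [this]
    exact hmd.add_left (i + j * d)
  have hmi : ∀ J ≤ m, m * i + J ≤ r := by
    intro J hJ
    calc m * i + J ≤ m * i + m := by omega
      _ = m * (i + 1) := by ring
      _ ≤ m * d.gcd r := Nat.mul_le_mul_left _ hig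
      _ = r := Nat.div_mul_cancel (Nat.gcd_dvd_right d r)
  -- The start of a cycle is a difference of two prefixes of the enumeration.
  have hshort : ∀ J ≤ m, |∑ j ∈ Finset.range J, h j| ≤ 2 * C := by
    intro J hJ
    have h1 : ∑ t ∈ Finset.range (m * i + J), f (cycleEnum r d t)
        = ∑ t ∈ Finset.range (m * i), f (cycleEnum r d t) + ∑ j ∈ Finset.range J, h j := by
      rw [Finset.sum_range_add]
      congr 1
      refine Finset.sum_congr rfl fun j hj => ?_
      have hjm : j < m := (Finset.mem_range.1 hj).trans_le hJ
      simp only [hh, cycleEnum, ← hm]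
      rw [Nat.mul_add_div hm0, Nat.div_eq_of_lt hjm, Nat.mul_add_mod, Nat.mod_eq_of_lt hjm,
        add_zero]
    have h2 := abs_le.1 (hpre _ (hmi J hJ))
    have h3 := abs_le.1 (hpre _ (hmi 0 (Nat.zero_le _)))
    rw [add_zero] at h3
    rw [abs_le]
    constructor <;> linarith [h2.1, h2.2, h3.1, h3.2]
  have hfull : |∑ j ∈ Finset.range m, h j| ≤ 1 := by
    simp only [hh, hm]
    rw [sum_cycle_eq_sum_modEq hr d hig]
    exact hcoset i
  -- The progression enters its cycle at step `k₀`: it is a prefix of `k₀ + l` steps minus one of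
  -- `k₀`. The first splits into full turns and a remainder, so two short pieces occur, whence `4 *
  -- C`.
  have hsum : ∑ k ∈ Finset.range l, f ((a + k * d) % r)
      = ∑ j ∈ Finset.range (k₀ + l), h j - ∑ j ∈ Finset.range k₀, h j := by
    rw [Finset.sum_range_add, add_sub_cancel_left]
    refine Finset.sum_congr rfl fun k _ => ?_
    simp only [hh]
    congr 1
    have h1 : a ≡ i + k₀ * d [MOD r] := by
      rw [Nat.ModEq, ← hta]
      simp [cycleEnum, hi, hk₀, hm]
    have h2 : i + (k₀ + k) * d = i + k₀ * d + k * d := by ring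
    rw [h2]
    exact h1.add_right (k * d)
  rw [hsum, ← Nat.div_add_mod (k₀ + l) m, sum_range_periodic h m hper]
  have h5 := hshort _ (Nat.mod_lt (k₀ + l) hm0).le
  have h6 := hshort _ hk₀m.le
  have h7 : |(((k₀ + l) / m : ℕ) : ℝ) * ∑ j ∈ Finset.range m, h j| ≤ (l : ℝ) / m + 1 := by
    rw [abs_mul, Nat.abs_cast]
    have h8 : (((k₀ + l) / m : ℕ) : ℝ) ≤ (l : ℝ) / m + 1 := by
      refine Nat.cast_div_le.trans ?_
      have hm' : (0 : ℝ) < m := by exact_mod_cast hm0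
      rw [div_add_one hm'.ne']
      have : (k₀ : ℝ) ≤ m := by exact_mod_cast hk₀m.le
      push_cast
      gcongr ?_ / _
      linarith
    calc _ ≤ ((l : ℝ) / m + 1) * 1 := mul_le_mul h8 hfull (abs_nonneg _) (by positivity)
      _ = _ := mul_one _
  have h5' := abs_le.1 h5
  have h6' := abs_le.1 h6
  have h7' := abs_le.1 h7
  rw [abs_le]
  constructor <;> linarith [h5'.1, h5'.2, h6'.1, h6'.2, h7'.1, h7'.2]

theorem add_mul_eq_natCast {n : ℕ} [NeZero n] (a d : ZMod n) (k : ℕ) :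
    a + (k : ZMod n) * d = ((a.val + k * d.val : ℕ) : ZMod n) := by
  push_cast
  rw [ZMod.natCast_zmod_val, ZMod.natCast_zmod_val]

theorem add_mul_eq_add_mul_iff {n : ℕ} [NeZero n] (a d : ZMod n) (k k' : ℕ) :
    a + (k : ZMod n) * d = a + (k' : ZMod n) * d ↔ k ≡ k' [MOD n / d.val.gcd n] := by
  rw [add_mul_eq_natCast, add_mul_eq_natCast, ZMod.natCast_eq_natCast_iff,
    ← mul_modEq_iff_div_gcd (NeZero.pos n)]
  exact ⟨fun h => Nat.ModEq.add_left_cancel' _ h, fun h => h.add_left _⟩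

/-- Progressions are sets, so the length may be cut at the period of the difference; sums over the
set then become sums over the index. -/
theorem exists_card_le_of_mem_modularAPs {n : ℕ} [NeZero n] {A : Finset (ZMod n)}
    (hA : A ∈ modularAPs n) : ∃ (a d : ZMod n) (l : ℕ), l ≤ n / d.val.gcd n ∧
      Set.InjOn (fun k : ℕ => a + (k : ZMod n) * d) (Finset.range l : Set ℕ) ∧
      A = (Finset.range l).image fun k : ℕ => a + (k : ZMod n) * d := by
  simp only [modularAPs, Finset.mem_filter, Finset.mem_univ, true_and] at hA
  obtain ⟨a, d, l, rfl⟩ := hA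
  set m := n / d.val.gcd n with hm
  have hm0 : 0 < m := div_gcd_pos (NeZero.pos n) d.val
  refine ⟨a, d, min l m, min_le_right _ _, ?_, ?_⟩
  · intro k hk k' hk' h
    simp only [Finset.coe_range, Set.mem_Iio, lt_min_iff] at hk hk'
    exact ((add_mul_eq_add_mul_iff a d k k').1 h).eq_of_lt_of_lt hk.2 hk'.2
  · ext y
    simp only [Finset.mem_image, Finset.mem_range, lt_min_iff]
    constructor
    · rintro ⟨k, hk, rfl⟩
      refine ⟨k % m, ⟨(Nat.mod_le _ _).trans_lt hk, Nat.mod_lt _ hm0⟩, ?_⟩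
      exact (add_mul_eq_add_mul_iff a d _ _).2 (Nat.mod_modEq k m)
    · rintro ⟨k, hk, rfl⟩
      exact ⟨k, hk.1, rfl⟩

theorem disc_modularAPs_le {n : ℕ} [NeZero n] {r : ℕ} (hrn : r ∣ n) :
    (disc (modularAPs n) : ℝ) ≤ (n : ℝ) / r + 2561 * √r * 2 ^ ω r := by
  have hn : 0 < n := NeZero.pos n
  have hr : 0 < r := Nat.pos_of_dvd_of_pos hrn hn
  obtain ⟨f, hf1, hf2, hf3⟩ := exists_balanced_coloring r hr
  set χ : ZMod n → ℤˣ := fun y => if f (y.val % r) = 1 then 1 else -1 with hχ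
  have hχf : ∀ y : ZMod n, (((χ y : ℤˣ) : ℤ) : ℝ) = f (y.val % r) := by
    intro y
    simp only [hχ]
    split_ifs with h
    · simp [h]
    · rcases (abs_eq zero_le_one).1 (hf1 (y.val % r)) with h1 | h1
      · exact absurd h1 h
      · simp [h1]
  refine le_trans ?_ (Nat.floor_le (by positivity))
  rw [Nat.cast_le]
  refine (Finset.inf'_le _ (Finset.mem_univ χ)).trans (Finset.sup_le fun A hA => Nat.le_floor ?_)
  obtain ⟨a, d, l, hl, hinj, rfl⟩ := exists_card_le_of_mem_modularAPs hA
  rw [Finset.sum_image hinj, Nat.cast_natAbs]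
  push_cast
  set e := d.val % r with he
  have hmod : ∀ k : ℕ, (a + (k : ZMod n) * d).val % r = (a.val + k * e) % r := by
    intro k
    rw [add_mul_eq_natCast, ZMod.val_natCast, Nat.mod_mod_of_dvd _ hrn]
    exact ((Nat.mod_modEq d.val r).symm.mul_left k).add_left a.val
  simp only [hχf, hmod]
  have hgcd : e.gcd r = d.val.gcd r := by
    rw [he, ← Nat.gcd_rec, Nat.gcd_comm]
  have h := abs_sum_progression_le hr f (640 * 2 ^ ω r * √r) e
    (hf2 _ (Nat.gcd_dvd_right e r)) (hf3 e (Nat.mod_lt _ hr)) a.val l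
  refine h.trans ?_
  have hm0 : 0 < r / e.gcd r := div_gcd_pos hr e
  -- The number of turns modulo `r` is at most `n / r` because `l * gcd(d, n) ≤ n` and `gcd(d, r) ≤
  -- gcd(d, n)`.
  have hlm : (l : ℝ) / (r / e.gcd r : ℕ) ≤ n / r := by
    rw [div_le_div_iff₀ (by exact_mod_cast hm0) (by exact_mod_cast hr)]
    have h1 : l * d.val.gcd r ≤ n := by
      calc l * d.val.gcd r ≤ n / d.val.gcd n * d.val.gcd n :=
            Nat.mul_le_mul hl (Nat.le_of_dvd (Nat.gcd_pos_of_pos_right _ hn)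
              (Nat.gcd_dvd_gcd_of_dvd_right _ hrn))
        _ = n := Nat.div_mul_cancel (Nat.gcd_dvd_right _ _)
    have h2 : l * r ≤ n * (r / e.gcd r) := by
      calc l * r = l * (e.gcd r * (r / e.gcd r)) := by
            rw [Nat.mul_div_cancel' (Nat.gcd_dvd_right e r)]
        _ = l * d.val.gcd r * (r / e.gcd r) := by rw [← mul_assoc, hgcd]
        _ ≤ _ := Nat.mul_le_mul_right _ h1
    exact_mod_cast h2
  have h1 : (1 : ℝ) ≤ √r := by
    rw [Real.one_le_sqrt]; exact_mod_cast hr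
  have h2 : (1 : ℝ) ≤ 2 ^ ω r := one_le_pow₀ one_le_two
  have h3 : (1 : ℝ) ≤ √r * 2 ^ ω r := by
    calc (1 : ℝ) = 1 * 1 := by ring
      _ ≤ _ := mul_le_mul h1 h2 zero_le_one (by positivity)
  -- `2561 = 4 * 640 + 1`, the extra `1` being absorbed by `√r * 2 ^ ω r ≥ 1`.
  linarith

/-! ### Fourier analysis and the lower bound. -/

theorem sum_norm_sq_fourier {n : ℕ} [NeZero n] (h : ZMod n → ℂ) :
    ∑ ξ : ZMod n, ‖∑ y, h y * ZMod.stdAddChar (y * ξ)‖ ^ 2 = n * ∑ y, ‖h y‖ ^ 2 := by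
  rw [← Complex.ofReal_inj]
  push_cast
  simp_rw [← Complex.mul_conj', map_sum, map_mul, Finset.sum_mul_sum, Finset.mul_sum]
  have h1 : ∀ ξ : ZMod n, ∀ y z : ZMod n,
      h y * ZMod.stdAddChar (y * ξ) * ((starRingEnd ℂ) (h z) *
        (starRingEnd ℂ) (ZMod.stdAddChar (z * ξ)))
      = h y * (starRingEnd ℂ) (h z) * ZMod.stdAddChar (ξ * (y - z)) := by
    intro ξ y z
    rw [← AddChar.map_neg_eq_conj, show ξ * (y - z) = y * ξ + -(z * ξ) by ring,
      AddChar.map_add_eq_mul]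
    ring
  simp_rw [h1]
  rw [Finset.sum_comm]
  refine Finset.sum_congr rfl fun y _ => ?_
  rw [Finset.sum_comm]
  simp_rw [← Finset.mul_sum, AddChar.sum_mulShift _ (ZMod.isPrimitive_stdAddChar n), sub_eq_zero,
    ZMod.card]
  simp [mul_comm]

theorem image_progression_mem_modularAPs {n : ℕ} [NeZero n] (a d : ZMod n) (l : ℕ) :
    ((Finset.range l).image fun k : ℕ => a + (k : ZMod n) * d) ∈ modularAPs n := by
  simp only [modularAPs, Finset.mem_filter, Finset.mem_univ, true_and]
  exact ⟨a, d, l, rfl⟩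

/-- The squared absolute value of the Fourier coefficient of `χ` at the frequency `ξ`. -/
noncomputable def fourierWeight {n : ℕ} [NeZero n] (χ : ZMod n → ℤˣ) (ξ : ZMod n) : ℝ :=
  ‖∑ y, (((χ y : ℤˣ) : ℤ) : ℂ) * ZMod.stdAddChar (y * ξ)‖ ^ 2

theorem fourierWeight_nonneg {n : ℕ} [NeZero n] (χ : ZMod n → ℤˣ) (ξ : ZMod n) :
    0 ≤ fourierWeight χ ξ := sq_nonneg _

theorem sum_fourierWeight {n : ℕ} [NeZero n] (χ : ZMod n → ℤˣ) :
    ∑ ξ, fourierWeight χ ξ = (n : ℝ) ^ 2 := by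
  simp only [fourierWeight]
  rw [sum_norm_sq_fourier]
  have : ∀ y, ‖(((χ y : ℤˣ) : ℤ) : ℂ)‖ ^ 2 = 1 := by
    intro y
    rcases Int.units_eq_one_or (χ y) with h | h <;> simp [h]
  simp_rw [this]
  simp [sq]

/-- The `L²` norm of the sums of `χ` over the progressions with difference `d` and length `L`,
computed on the Fourier side, bounds the discrepancy of `χ` from below. -/
theorem sum_fourier_mul_le {n : ℕ} [NeZero n] (χ : ZMod n → ℤˣ) (D : ℝ) (d : ZMod n) (L : ℕ)
    (hinj : Set.InjOn (fun k : ℕ => (k : ZMod n) * d) (Finset.range L : Set ℕ))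
    (hD : ∀ A ∈ modularAPs n, |∑ y ∈ A, (((χ y : ℤˣ) : ℤ) : ℝ)| ≤ D) :
    ∑ ξ : ZMod n, fourierWeight χ ξ *
      ‖∑ k ∈ Finset.range L, (ZMod.stdAddChar (-((k : ZMod n) * d * ξ)) : ℂ)‖ ^ 2
      ≤ (n : ℝ) ^ 2 * D ^ 2 := by
  simp only [fourierWeight]
  have hpars := sum_norm_sq_fourier fun a : ZMod n =>
    ∑ k ∈ Finset.range L, (((χ (a + (k : ZMod n) * d) : ℤˣ) : ℤ) : ℂ)
  -- Summing along progressions is a convolution, so it acts on Fourier coefficients by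
  -- multiplication.
  have hfac : ∀ ξ : ZMod n, ∑ y : ZMod n,
      (∑ k ∈ Finset.range L, (((χ (y + (k : ZMod n) * d) : ℤˣ) : ℤ) : ℂ)) *
        ZMod.stdAddChar (y * ξ)
      = (∑ y, (((χ y : ℤˣ) : ℤ) : ℂ) * ZMod.stdAddChar (y * ξ)) *
        ∑ k ∈ Finset.range L, (ZMod.stdAddChar (-((k : ZMod n) * d * ξ)) : ℂ) := by
    intro ξ
    simp_rw [Finset.sum_mul, Finset.mul_sum]
    rw [Finset.sum_comm]
    conv_rhs => rw [Finset.sum_comm]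
    refine Finset.sum_congr rfl fun k _ => ?_
    refine Fintype.sum_equiv (Equiv.addRight ((k : ZMod n) * d)) _ _ fun y => ?_
    simp only [Equiv.coe_addRight]
    rw [mul_assoc, ← AddChar.map_add_eq_mul]
    congr 2
    ring
  simp_rw [hfac, norm_mul, mul_pow] at hpars
  rw [hpars]
  have hterm : ∀ a : ZMod n,
      ‖∑ k ∈ Finset.range L, (((χ (a + (k : ZMod n) * d) : ℤˣ) : ℤ) : ℂ)‖ ^ 2 ≤ D ^ 2 := by
    intro a
    have h1 := hD _ (image_progression_mem_modularAPs a d L)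
    rw [Finset.sum_image fun k hk k' hk' h => hinj hk hk' (add_left_cancel h)] at h1
    have h2 : ‖∑ k ∈ Finset.range L, (((χ (a + (k : ZMod n) * d) : ℤˣ) : ℤ) : ℂ)‖
        = |∑ k ∈ Finset.range L, (((χ (a + (k : ZMod n) * d) : ℤˣ) : ℤ) : ℝ)| := by
      rw [← Real.norm_eq_abs, ← Complex.norm_real]
      push_cast
      rfl
    rw [h2]
    exact pow_le_pow_left₀ (abs_nonneg _) h1 2
  calc (n : ℝ) * ∑ a : ZMod n,
        ‖∑ k ∈ Finset.range L, (((χ (a + (k : ZMod n) * d) : ℤˣ) : ℤ) : ℂ)‖ ^ 2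
      ≤ n * ∑ a : ZMod n, D ^ 2 :=
        mul_le_mul_of_nonneg_left (Finset.sum_le_sum fun a _ => hterm a) (by positivity)
    _ = _ := by
        rw [Finset.sum_const, Finset.card_univ, ZMod.card, nsmul_eq_mul]
        ring

/-- With `r` the order, `ξ = (n / r) * u` for some `u` coprime to `r`; take `d` inverse to `u`
modulo `r`. This moves every frequency of order `r` to the single frequency `n / r`. -/
theorem exists_mul_eq_div_addOrderOf {n : ℕ} [NeZero n] (ξ : ZMod n) :
    ∃ d < addOrderOf ξ, d.Coprime (addOrderOf ξ) ∧
      (d : ZMod n) * ξ = ((n / addOrderOf ξ : ℕ) : ZMod n) := by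
  have hn : n ≠ 0 := NeZero.ne n
  set g := n.gcd ξ.val with hg
  have hg0 : 0 < g := Nat.gcd_pos_of_pos_left _ (Nat.pos_of_ne_zero hn)
  have hord : addOrderOf ξ = n / g := by
    conv_lhs => rw [← ZMod.natCast_zmod_val ξ]
    exact ZMod.addOrderOf_coe _ hn
  rw [hord]
  set r := n / g with hr
  have hgn : g * r = n := Nat.mul_div_cancel' (Nat.gcd_dvd_left _ _)
  have hr0 : 0 < r := by
    rcases Nat.eq_zero_or_pos r with h | h
    · rw [h, mul_zero] at hgn; exact absurd hgn.symm hn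
    · exact h
  have hnr : n / r = g := Nat.div_eq_of_eq_mul_left hr0 hgn.symm
  set u := ξ.val / g with hu
  have hgu : g * u = ξ.val := Nat.mul_div_cancel' (Nat.gcd_dvd_right _ _)
  have hcop : r.Coprime u := Nat.coprime_div_gcd_div_gcd hg0
  obtain ⟨d, hd, hdu⟩ : ∃ d < r, u * d ≡ 1 [MOD r] := by
    rcases Nat.lt_or_ge 1 r with h1 | h1
    · obtain ⟨m, hm, h⟩ := Nat.exists_mul_mod_eq_one_of_coprime hcop.symm h1
      exact ⟨m, hm, by rw [Nat.ModEq, h, Nat.mod_eq_of_lt h1]⟩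
    · have : r = 1 := by omega
      exact ⟨0, hr0, by rw [this]; exact Nat.modEq_one⟩
  refine ⟨d, hd, ?_, ?_⟩
  · have h1 := hdu.gcd_eq
    rw [Nat.gcd_one_left] at h1
    exact Nat.Coprime.coprime_mul_left (k := u) h1
  · rw [hnr]
    conv_lhs => rw [← ZMod.natCast_zmod_val ξ, ← hgu]
    rw [← Nat.cast_mul, ZMod.natCast_eq_natCast_iff]
    have h1 := Nat.ModEq.mul_left' g hdu
    rw [hgn, mul_one] at h1
    rwa [show d * (g * u) = g * (u * d) by ring]

theorem half_le_norm_sum_stdAddChar {n r : ℕ} [NeZero n] (hrn : r ∣ n) :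
    (r : ℝ) / 6 ≤ ‖∑ k ∈ Finset.range (r / 3 + 1),
      (ZMod.stdAddChar (-((k : ZMod n) * ((n / r : ℕ) : ZMod n))) : ℂ)‖ := by
  have hn : 0 < n := NeZero.pos n
  have hr : 0 < r := Nat.pos_of_dvd_of_pos hrn hn
  have hrR : (0 : ℝ) < r := by exact_mod_cast hr
  have hval : ∀ k : ℕ, (ZMod.stdAddChar (-((k : ZMod n) * ((n / r : ℕ) : ZMod n))) : ℂ)
      = Complex.exp (((-(2 * Real.pi * (k / r)) : ℝ) : ℂ) * Complex.I) := by
    intro k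
    obtain ⟨q, hq⟩ : ∃ q, n / r = q := ⟨_, rfl⟩
    have hqn : r * q = n := by rw [← hq, Nat.mul_div_cancel' hrn]
    have h1 := ZMod.stdAddChar_coe (N := n) (-((k : ℤ) * (q : ℤ)))
    push_cast at h1
    rw [hq, h1]
    congr 1
    have hnC : (n : ℂ) ≠ 0 := by exact_mod_cast hn.ne'
    have hrC : (r : ℂ) ≠ 0 := by exact_mod_cast hr.ne'
    have hqC : (r : ℂ) * q = n := by exact_mod_cast hqn
    push_cast
    field_simp
    linear_combination (-(k : ℂ)) * hqC
  set S := ∑ k ∈ Finset.range (r / 3 + 1),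
      (ZMod.stdAddChar (-((k : ZMod n) * ((n / r : ℕ) : ZMod n))) : ℂ) with hS
  -- The terms fill an arc of angle at most `2π/3`. Rotated by `π/3`, it is within `π/3` of the
  -- positive real axis, so each real part is at least `1 / 2`.
  have hrot : ‖S‖ = ‖Complex.exp (((Real.pi / 3 : ℝ) : ℂ) * Complex.I) * S‖ := by
    rw [norm_mul, Complex.norm_exp_ofReal_mul_I, one_mul]
  rw [hrot]
  refine le_trans ?_ (Complex.re_le_norm _)
  rw [hS, Finset.mul_sum, Complex.re_sum]
  have hterm : ∀ k ∈ Finset.range (r / 3 + 1), (1 / 2 : ℝ) ≤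
      (Complex.exp (((Real.pi / 3 : ℝ) : ℂ) * Complex.I) *
        (ZMod.stdAddChar (-((k : ZMod n) * ((n / r : ℕ) : ZMod n))) : ℂ)).re := by
    intro k hk
    rw [hval, ← Complex.exp_add, ← add_mul, ← Complex.ofReal_add, Complex.exp_ofReal_mul_I_re,
      ← Real.cos_pi_div_three, ← Real.cos_abs (_ + _)]
    have hk3 : 3 * (k : ℝ) ≤ r := by
      have : k ≤ r / 3 := Nat.lt_succ_iff.1 (Finset.mem_range.1 hk)
      have h4 : 3 * k ≤ r := by omega
      exact_mod_cast h4
    have hk0 : (0 : ℝ) ≤ (k : ℝ) / r := by positivity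
    have hk1 : (k : ℝ) / r ≤ 1 / 3 := by
      rw [div_le_div_iff₀ hrR (by norm_num)]
      linarith
    have hpi := Real.pi_pos
    refine Real.cos_le_cos_of_nonneg_of_le_pi (abs_nonneg _) (by linarith) ?_
    rw [abs_le]
    constructor <;> nlinarith
  have hlow := Finset.sum_le_sum hterm
  refine le_trans ?_ hlow
  rw [Finset.sum_const, Finset.card_range, nsmul_eq_mul]
  have h5 : r ≤ 3 * (r / 3 + 1) := by omega
  have h6 : (r : ℝ) ≤ 3 * ((r / 3 + 1 : ℕ) : ℝ) := by exact_mod_cast h5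
  linarith

theorem natCast_mul_natCast_injOn {n r d L : ℕ} [NeZero n] (hrn : r ∣ n) (hd : d.Coprime r)
    (hL : L ≤ r) :
    Set.InjOn (fun k : ℕ => (k : ZMod n) * (d : ZMod n)) (Finset.range L : Set ℕ) := by
  intro k hk k' hk' h
  simp only [Finset.coe_range, Set.mem_Iio] at hk hk'
  have h1 : ((k * d : ℕ) : ZMod n) = ((k' * d : ℕ) : ZMod n) := by push_cast; exact h
  rw [ZMod.natCast_eq_natCast_iff] at h1
  have h2 := Nat.ModEq.cancel_right_of_coprime hd.symm (h1.of_dvd hrn)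
  exact h2.eq_of_lt_of_lt (hk.trans_le hL) (hk'.trans_le hL)

theorem exists_addOrderOf_mass {n : ℕ} [NeZero n] (w : ZMod n → ℝ) :
    ∃ r ∈ n.divisors, (∑ ξ, w ξ) / n.divisors.card ≤
      ∑ ξ ∈ Finset.univ.filter fun ξ : ZMod n => addOrderOf ξ = r, w ξ := by
  have hn : n ≠ 0 := NeZero.ne n
  have hne : n.divisors.Nonempty := Nat.nonempty_divisors.2 hn
  have hmaps : ∀ ξ ∈ (Finset.univ : Finset (ZMod n)), addOrderOf ξ ∈ n.divisors := by
    intro ξ _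
    rw [Nat.mem_divisors]
    refine ⟨?_, hn⟩
    have := addOrderOf_dvd_card (x := ξ)
    rwa [ZMod.card] at this
  refine Finset.exists_le_of_sum_le hne ?_
  rw [Finset.sum_fiberwise_of_maps_to hmaps, Finset.sum_const, nsmul_eq_mul,
    mul_div_cancel₀]
  exact_mod_cast hne.card_pos.ne'

/-- Test with cosets of the subgroup generated by `r`. A frequency of order `r` is trivial on it, so
the multiplier is the full length `n / r`. -/
theorem sum_fourierWeight_mul_coset_le {n r : ℕ} [NeZero n] (hrn : r ∣ n) (χ : ZMod n → ℤˣ) (D : ℝ)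
    (hD : ∀ A ∈ modularAPs n, |∑ y ∈ A, (((χ y : ℤˣ) : ℤ) : ℝ)| ≤ D) :
    (∑ ξ ∈ Finset.univ.filter fun ξ : ZMod n => addOrderOf ξ = r, fourierWeight χ ξ) *
      ((n : ℝ) / r) ^ 2 ≤ (n : ℝ) ^ 2 * D ^ 2 := by
  have hr0 : 0 < r := Nat.pos_of_dvd_of_pos hrn (NeZero.pos n)
  have hinj : Set.InjOn (fun k : ℕ => (k : ZMod n) * (r : ZMod n))
      (Finset.range (n / r) : Set ℕ) := by
    intro k hk k' hk' h
    simp only [Finset.coe_range, Set.mem_Iio] at hk hk'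
    have h1 : ((k * r : ℕ) : ZMod n) = ((k' * r : ℕ) : ZMod n) := by push_cast; exact h
    rw [ZMod.natCast_eq_natCast_iff] at h1
    have hlt : ∀ j < n / r, j * r < n := fun j hj => by
      rwa [Nat.lt_div_iff_mul_lt' hrn, mul_comm] at hj
    exact Nat.eq_of_mul_eq_mul_right hr0 (h1.eq_of_lt_of_lt (hlt k hk) (hlt k' hk'))
  refine le_trans ?_ (sum_fourier_mul_le χ D (r : ZMod n) (n / r) hinj hD)
  refine le_trans (le_of_eq ?_) (Finset.sum_le_sum_of_subset_of_nonneg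
    (Finset.filter_subset (fun ξ : ZMod n => addOrderOf ξ = r) _)
    fun ξ _ _ => mul_nonneg (fourierWeight_nonneg χ ξ) (sq_nonneg _))
  rw [Finset.sum_mul]
  refine Finset.sum_congr rfl fun ξ hξ => ?_
  have hord : addOrderOf ξ = r := (Finset.mem_filter.1 hξ).2
  have hrξ : (r : ZMod n) * ξ = 0 := by
    rw [← nsmul_eq_mul, ← hord, addOrderOf_nsmul_eq_zero]
  simp only [mul_assoc, hrξ, mul_zero, neg_zero, AddChar.map_zero_eq_one,
    Finset.sum_const, Finset.card_range, nsmul_eq_mul, mul_one, Complex.norm_natCast]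
  rw [Nat.cast_div hrn (by exact_mod_cast hr0.ne')]

/-- Test with all differences coprime to `r` at once: each frequency of order `r` has a large
multiplier for at least one of them, and there are at most `r`. -/
theorem sum_fourierWeight_mul_units_le {n r : ℕ} [NeZero n] (hrn : r ∣ n) (χ : ZMod n → ℤˣ) (D : ℝ)
    (hD : ∀ A ∈ modularAPs n, |∑ y ∈ A, (((χ y : ℤˣ) : ℤ) : ℝ)| ≤ D) :
    (∑ ξ ∈ Finset.univ.filter fun ξ : ZMod n => addOrderOf ξ = r, fourierWeight χ ξ) *
      ((r : ℝ) / 6) ^ 2 ≤ r * ((n : ℝ) ^ 2 * D ^ 2) := by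
  have hr0 : 0 < r := Nat.pos_of_dvd_of_pos hrn (NeZero.pos n)
  set T := (Finset.range r).filter fun d => d.Coprime r with hT
  have hL : r / 3 + 1 ≤ r := by omega
  let G : ZMod n → ℕ → ℝ := fun ξ d => fourierWeight χ ξ *
    ‖∑ k ∈ Finset.range (r / 3 + 1), (ZMod.stdAddChar (-((k : ZMod n) * (d : ZMod n) * ξ)) : ℂ)‖ ^ 2
  have hG0 : ∀ ξ d, 0 ≤ G ξ d := fun ξ d => mul_nonneg (fourierWeight_nonneg χ ξ) (sq_nonneg _)
  have h1 : ∀ d ∈ T, ∑ ξ, G ξ d ≤ (n : ℝ) ^ 2 * D ^ 2 := fun d hd =>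
    sum_fourier_mul_le χ D (d : ZMod n) _
      (natCast_mul_natCast_injOn hrn (Finset.mem_filter.1 hd).2 hL) hD
  calc (∑ ξ ∈ Finset.univ.filter fun ξ : ZMod n => addOrderOf ξ = r, fourierWeight χ ξ) *
        ((r : ℝ) / 6) ^ 2
      ≤ ∑ ξ ∈ Finset.univ.filter fun ξ : ZMod n => addOrderOf ξ = r, ∑ d ∈ T, G ξ d := by
        rw [Finset.sum_mul]
        refine Finset.sum_le_sum fun ξ hξ => ?_
        have hord : addOrderOf ξ = r := (Finset.mem_filter.1 hξ).2
        obtain ⟨d, hd, hdc, hdξ⟩ := exists_mul_eq_div_addOrderOf ξ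
        rw [hord] at hd hdc hdξ
        have hdT : d ∈ T := Finset.mem_filter.2 ⟨Finset.mem_range.2 hd, hdc⟩
        refine le_trans ?_ (Finset.single_le_sum (fun d _ => hG0 ξ d) hdT)
        simp only [G, mul_assoc, hdξ]
        exact mul_le_mul_of_nonneg_left
          (pow_le_pow_left₀ (by positivity) (half_le_norm_sum_stdAddChar hrn) 2)
          (fourierWeight_nonneg χ ξ)
    _ ≤ ∑ ξ, ∑ d ∈ T, G ξ d :=
        Finset.sum_le_sum_of_subset_of_nonneg (Finset.filter_subset _ _)
          fun ξ _ _ => Finset.sum_nonneg fun d _ => hG0 ξ d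
    _ ≤ ∑ d ∈ T, (n : ℝ) ^ 2 * D ^ 2 := by
        rw [Finset.sum_comm]
        exact Finset.sum_le_sum h1
    _ ≤ r * ((n : ℝ) ^ 2 * D ^ 2) := by
        rw [Finset.sum_const, nsmul_eq_mul]
        refine mul_le_mul_of_nonneg_right ?_ (by positivity)
        exact_mod_cast (Finset.card_filter_le _ _).trans (by simp)

theorem le_of_forall_mem_modularAPs {n : ℕ} [NeZero n] (χ : ZMod n → ℤˣ) (D : ℝ)
    (hD : ∀ A ∈ modularAPs n, |∑ y ∈ A, (((χ y : ℤˣ) : ℤ) : ℝ)| ≤ D) :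
    ∃ r ∈ n.divisors, (n : ℝ) / r + √r ≤ 7 * (√(n.divisors.card : ℝ) * D) := by
  have hn : 0 < n := NeZero.pos n
  have hnR : (0 : ℝ) < n := by exact_mod_cast hn
  have hD0 : 0 ≤ D := (abs_nonneg _).trans (hD _ (image_progression_mem_modularAPs 0 0 0))
  obtain ⟨r, hr, hmass⟩ := exists_addOrderOf_mass (fourierWeight χ)
  rw [sum_fourierWeight] at hmass
  refine ⟨r, hr, ?_⟩
  have hrn : r ∣ n := Nat.dvd_of_mem_divisors hr
  have hr0 : 0 < r := Nat.pos_of_dvd_of_pos hrn hn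
  have hrR : (0 : ℝ) < r := by exact_mod_cast hr0
  have hK0 : (0 : ℝ) < (n.divisors.card : ℝ) := by
    exact_mod_cast Finset.card_pos.2 ⟨r, hr⟩
  set K : ℝ := (n.divisors.card : ℝ)
  have key : ∀ x : ℝ, (n : ℝ) ^ 2 / K * x ^ 2 ≤ (n : ℝ) ^ 2 * D ^ 2 → x ≤ √K * D := by
    intro x hx
    have h1 : x ^ 2 ≤ (√K * D) ^ 2 := by
      rw [mul_pow, Real.sq_sqrt hK0.le, ← div_le_iff₀' hK0]
      have h2 : (n : ℝ) ^ 2 * (x ^ 2 / K) ≤ (n : ℝ) ^ 2 * D ^ 2 :=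
        le_trans (le_of_eq (by ring)) hx
      exact le_of_mul_le_mul_left h2 (by positivity)
    exact (abs_le_of_sq_le_sq' h1 (by positivity)).2
  have hcoset : (n : ℝ) / r ≤ √K * D := key _ ((mul_le_mul_of_nonneg_right hmass
    (sq_nonneg _)).trans (sum_fourierWeight_mul_coset_le hrn χ D hD))
  have hunit : √r / 6 ≤ √K * D := by
    refine key _ ?_
    have h3 := (mul_le_mul_of_nonneg_right hmass (sq_nonneg ((r : ℝ) / 6))).trans
      (sum_fourierWeight_mul_units_le hrn χ D hD)
    refine le_of_mul_le_mul_left (le_trans (le_of_eq ?_) h3) hrR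
    rw [div_pow, Real.sq_sqrt hrR.le]
    ring
  linarith

theorem exists_dvd_add_sqrt_le_disc (n : ℕ) [NeZero n] :
    ∃ r ∈ n.divisors, (n : ℝ) / r + √r ≤ 8 * √n.divisors.card * disc (modularAPs n) := by
  obtain ⟨χ, -, hχ⟩ := Finset.exists_mem_eq_inf' (Finset.univ_nonempty (α := ZMod n → ℤˣ))
    fun χ => (modularAPs n).sup fun A => (∑ x ∈ A, (χ x : ℤ)).natAbs
  have hdisc : disc (modularAPs n) = (modularAPs n).sup fun A => (∑ x ∈ A, (χ x : ℤ)).natAbs := hχ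
  obtain ⟨r, hr, h⟩ := le_of_forall_mem_modularAPs χ (disc (modularAPs n)) fun A hA => by
    have h1 : (∑ x ∈ A, (χ x : ℤ)).natAbs ≤ disc (modularAPs n) := by
      rw [hdisc]
      exact Finset.le_sup (f := fun A => (∑ x ∈ A, (χ x : ℤ)).natAbs) hA
    have h2 : (((∑ x ∈ A, (χ x : ℤ)).natAbs : ℕ) : ℝ) ≤ disc (modularAPs n) := by exact_mod_cast h1
    rw [Nat.cast_natAbs] at h2
    push_cast at h2
    exact h2
  refine ⟨r, hr, h.trans ?_⟩
  have : 0 ≤ √(n.divisors.card : ℝ) * (disc (modularAPs n) : ℝ) := by positivity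
  linarith

/-! ### The divisor bound. -/

/-- For the finitely many small primes in the divisor bound, where a constant factor per prime is
affordable. Large primes, with `p ^ ε ≥ 2`, need no constant. -/
theorem exists_succ_le_mul_rpow {ε : ℝ} (hε : 0 < ε) :
    ∃ K : ℝ, 1 ≤ K ∧ ∀ p : ℕ, 2 ≤ p → ∀ a : ℕ, (a : ℝ) + 1 ≤ K * (p : ℝ) ^ (ε * a) := by
  have hlog : 0 < ε * Real.log 2 := mul_pos hε (Real.log_pos one_lt_two)
  refine ⟨max 1 (1 / (ε * Real.log 2)), le_max_left _ _, fun p hp a => ?_⟩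
  set K := max 1 (1 / (ε * Real.log 2))
  have hK1 : 1 ≤ K := le_max_left _ _
  have hK2 : 1 ≤ K * (ε * Real.log 2) := by
    rw [← div_le_iff₀ hlog]; exact le_max_right _ _
  have h1 : ε * Real.log 2 * a + 1 ≤ (p : ℝ) ^ (ε * a) := by
    calc ε * Real.log 2 * a + 1 ≤ Real.exp (ε * Real.log 2 * a) := Real.add_one_le_exp _
      _ = (2 : ℝ) ^ (ε * a) := by
          rw [Real.rpow_def_of_pos two_pos]; congr 1; ring
      _ ≤ (p : ℝ) ^ (ε * a) := by
          refine Real.rpow_le_rpow two_pos.le (by exact_mod_cast hp) (by positivity)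
  have ha : (0 : ℝ) ≤ a := by positivity
  calc (a : ℝ) + 1 ≤ K * (ε * Real.log 2) * a + K := by nlinarith
    _ = K * (ε * Real.log 2 * a + 1) := by ring
    _ ≤ _ := by gcongr

theorem exists_succ_le_rpow {ε : ℝ} (hε : 0 < ε) :
    ∃ P : ℕ, ∀ p : ℕ, P ≤ p → ∀ a : ℕ, (a : ℝ) + 1 ≤ (p : ℝ) ^ (ε * a) := by
  refine ⟨⌈(2 : ℝ) ^ (1 / ε)⌉₊, fun p hp a => ?_⟩
  have h1 : (2 : ℝ) ^ (1 / ε) ≤ p := (Nat.le_ceil _).trans (by exact_mod_cast hp)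
  have h2 : (2 : ℝ) ≤ (p : ℝ) ^ ε := by
    calc (2 : ℝ) = ((2 : ℝ) ^ (1 / ε)) ^ ε := by
          rw [← Real.rpow_mul two_pos.le, one_div_mul_cancel hε.ne', Real.rpow_one]
      _ ≤ _ := Real.rpow_le_rpow (by positivity) h1 hε.le
  calc (a : ℝ) + 1 ≤ (2 : ℝ) ^ a := by exact_mod_cast Nat.lt_two_pow_self
    _ ≤ ((p : ℝ) ^ ε) ^ a := pow_le_pow_left₀ two_pos.le h2 a
    _ = (p : ℝ) ^ (ε * a) := by rw [Real.rpow_mul (by positivity), Real.rpow_natCast]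

/-- The divisor bound `d(n) = O(n ^ ε)`. -/
theorem exists_card_divisors_le_mul_rpow {ε : ℝ} (hε : 0 < ε) :
    ∃ C : ℝ, 1 ≤ C ∧ ∀ n : ℕ, n ≠ 0 → (n.divisors.card : ℝ) ≤ C * (n : ℝ) ^ ε := by
  obtain ⟨K, hK1, hK⟩ := exists_succ_le_mul_rpow hε
  obtain ⟨P, hP⟩ := exists_succ_le_rpow hε
  refine ⟨K ^ P, one_le_pow₀ hK1, fun n hn => ?_⟩
  rw [Nat.card_divisors hn]
  push_cast
  calc ∏ p ∈ n.primeFactors, ((n.factorization p : ℝ) + 1)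
      ≤ ∏ p ∈ n.primeFactors, (if p < P then K else 1) * (p : ℝ) ^ (ε * n.factorization p) := by
        refine Finset.prod_le_prod (fun p _ => by positivity) fun p hp => ?_
        split_ifs with h
        · exact hK p (Nat.prime_of_mem_primeFactors hp).two_le _
        · rw [one_mul]; exact hP p (not_lt.1 h) _
    _ = (∏ p ∈ n.primeFactors, if p < P then K else 1) *
          ∏ p ∈ n.primeFactors, (p : ℝ) ^ (ε * n.factorization p) := Finset.prod_mul_distrib
    _ ≤ K ^ P * (n : ℝ) ^ ε := by
        refine mul_le_mul ?_ (le_of_eq ?_) (Finset.prod_nonneg fun p _ => by positivity)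
          (by positivity)
        · rw [Finset.prod_ite, Finset.prod_const, Finset.prod_const_one, mul_one]
          refine pow_le_pow_right₀ hK1 ?_
          refine (Finset.card_le_card (t := Finset.range P) fun p hp => ?_).trans (by simp)
          exact Finset.mem_range.2 (Finset.mem_filter.1 hp).2
        · conv_rhs => rw [← Nat.prod_factorization_pow_eq_self hn]
          rw [Finsupp.prod, Nat.support_factorization]
          push_cast
          rw [← Real.finsetProd_rpow _ _ fun p _ => by positivity]
          refine Finset.prod_congr rfl fun p _ => ?_
          rw [mul_comm, Real.rpow_mul (by positivity), Real.rpow_natCast]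

theorem tendsto_log_mul_card_divisors_div_log {C : ℝ} (hC : 1 ≤ C) :
    Filter.Tendsto (fun n : ℕ => Real.log (C * n.divisors.card) / Real.log n) Filter.atTop
      (nhds 0) := by
  have hlog : Filter.Tendsto (fun n : ℕ => Real.log n) Filter.atTop Filter.atTop :=
    Real.tendsto_log_atTop.comp tendsto_natCast_atTop_atTop
  rw [Metric.tendsto_nhds]
  intro ε hε
  obtain ⟨B, hB1, hB⟩ := exists_card_divisors_le_mul_rpow (half_pos hε)
  filter_upwards [hlog.eventually_gt_atTop (2 * Real.log (C * B) / ε),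
    Filter.eventually_ge_atTop 2] with n h1 h2
  have hn0 : n ≠ 0 := by omega
  have hn : (1 : ℝ) < n := by exact_mod_cast h2
  have hln : 0 < Real.log n := Real.log_pos hn
  have hd : (1 : ℝ) ≤ n.divisors.card := by
    exact_mod_cast (Nat.nonempty_divisors.2 hn0).card_pos
  have h3 : 0 ≤ Real.log (C * n.divisors.card) := Real.log_nonneg (by nlinarith)
  rw [Real.dist_eq, sub_zero, abs_of_nonneg (by positivity), div_lt_iff₀ hln]
  have h4 : Real.log (C * n.divisors.card) ≤ Real.log (C * B) + ε / 2 * Real.log n := by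
    rw [← Real.log_rpow (by linarith), ← Real.log_mul (by positivity) (by positivity), mul_assoc]
    refine Real.log_le_log (by positivity) ?_
    exact mul_le_mul_of_nonneg_left (hB n hn0) (by positivity)
  rw [div_lt_iff₀ hε] at h1
  linarith

theorem two_pow_cardDistinctFactors_le_card_divisors {n : ℕ} (hn : n ≠ 0) :
    2 ^ ω n ≤ n.divisors.card := by
  rw [Nat.card_divisors hn, ArithmeticFunction.cardDistinctFactors_apply,
    ← List.card_toFinset, ← Finset.prod_const]
  refine Finset.prod_le_prod' fun p hp => ?_
  have := (Nat.prime_of_mem_primeFactors hp).factorization_pos_of_dvd hn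
    (Nat.dvd_of_mem_primeFactors hp)
  omega

/-! ### Gap exponents and the final estimates. -/

/-- The largest `x` such that `r` does not lie in `(n ^ (2/3 - x), n ^ (2/3 + 2x))`. -/
noncomputable def gapExponent (n r : ℕ) : ℝ :=
  max (2 / 3 - Real.logb n r) ((Real.logb n r - 2 / 3) / 2)

theorem gapExponent_nonneg (n r : ℕ) : 0 ≤ gapExponent n r := by
  rcases le_total (Real.logb n r) (2 / 3) with h | h
  · exact le_max_of_le_left (by linarith)
  · exact le_max_of_le_right (by linarith)

theorem notMem_Ioo_iff_le_gapExponent {n r : ℕ} (hn : 2 ≤ n) (hr : 0 < r) (x : ℝ) :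
    (r : ℝ) ∉ Set.Ioo ((n : ℝ) ^ (2 / 3 - x : ℝ)) ((n : ℝ) ^ (2 / 3 + 2 * x : ℝ)) ↔
      x ≤ gapExponent n r := by
  have hn1 : (1 : ℝ) < n := by exact_mod_cast hn
  have hr0 : (0 : ℝ) < r := by exact_mod_cast hr
  rw [Set.mem_Ioo, ← Real.lt_logb_iff_rpow_lt hn1 hr0, ← Real.logb_lt_iff_lt_rpow hn1 hr0,
    gapExponent, le_max_iff, not_and_or, not_lt, not_lt]
  constructor <;> rintro (h | h)
  · left; linarith
  · right; linarith
  · left; linarith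
  · right; linarith

/-- With `r = n ^ ρ` the two summands are `n ^ (1 - ρ)` and `n ^ (ρ / 2)`, which agree at `ρ = 2/3`.
The gap exponent is the excess of the larger exponent over `1/3`, and a sum of two terms is at most
twice the larger. -/
theorem rpow_gapExponent_bounds {n r : ℕ} (hn : 2 ≤ n) (hr : 0 < r) :
    (n : ℝ) ^ (1 / 3 + gapExponent n r) ≤ (n : ℝ) / r + √r ∧
      (n : ℝ) / r + √r ≤ 2 * (n : ℝ) ^ (1 / 3 + gapExponent n r) := by
  have hn1 : (1 : ℝ) < n := by exact_mod_cast hn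
  have hn0 : (0 : ℝ) < n := by linarith
  have hr0 : (0 : ℝ) < r := by exact_mod_cast hr
  set ρ := Real.logb n r with hρ
  have hrρ : (n : ℝ) ^ ρ = r := Real.rpow_logb hn0 hn1.ne' hr0
  have h1 : (n : ℝ) / r = (n : ℝ) ^ (1 - ρ) := by
    rw [Real.rpow_sub hn0, hrρ, Real.rpow_one]
  have h2 : √(r : ℝ) = (n : ℝ) ^ (ρ / 2) := by
    rw [Real.sqrt_eq_rpow, ← hrρ, ← Real.rpow_mul hn0.le]
    congr 1
    ring
  rw [h1, h2]
  have hp1 : 0 ≤ (n : ℝ) ^ (1 - ρ) := by positivity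
  have hp2 : 0 ≤ (n : ℝ) ^ (ρ / 2) := by positivity
  have hg1 : 1 - ρ ≤ 1 / 3 + gapExponent n r := by
    have := le_max_left (2 / 3 - ρ) ((ρ - 2 / 3) / 2)
    simp only [gapExponent, ← hρ]
    linarith
  have hg2 : ρ / 2 ≤ 1 / 3 + gapExponent n r := by
    have := le_max_right (2 / 3 - ρ) ((ρ - 2 / 3) / 2)
    simp only [gapExponent, ← hρ]
    linarith
  refine ⟨?_, ?_⟩
  · rcases max_choice (2 / 3 - ρ) ((ρ - 2 / 3) / 2) with h | h
    · have : 1 / 3 + gapExponent n r = 1 - ρ := by simp only [gapExponent, ← hρ, h]; ring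
      rw [this]; linarith
    · have : 1 / 3 + gapExponent n r = ρ / 2 := by simp only [gapExponent, ← hρ, h]; ring
      rw [this]; linarith
  · have k1 := Real.rpow_le_rpow_of_exponent_le hn1.le hg1
    have k2 := Real.rpow_le_rpow_of_exponent_le hn1.le hg2
    linarith

theorem isGreatest_divisorGaps {n : ℕ} [NeZero n] (hn : 2 ≤ n) :
    IsGreatest (divisorGaps n) (minOverDivisors n (gapExponent n)) := by
  have hmem : ∀ x, x ∈ divisorGaps n ↔ 0 ≤ x ∧ ∀ r ∈ n.divisors, x ≤ gapExponent n r := by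
    intro x
    simp only [divisorGaps, Set.mem_ofPred_eq]
    refine and_congr_right fun _ => forall₂_congr fun r hr => ?_
    exact notMem_Ioo_iff_le_gapExponent hn (Nat.pos_of_mem_divisors hr) x
  constructor
  · rw [hmem]
    exact ⟨Finset.le_inf' _ _ fun r _ => gapExponent_nonneg n r, fun r hr => Finset.inf'_le _ hr⟩
  · intro y hy
    exact Finset.le_inf' _ _ ((hmem y).1 hy).2

theorem disc_modularAPs_rpow_bounds {n : ℕ} [NeZero n] (hn : 2 ≤ n) :
    (n : ℝ) ^ (1 / 3 + minOverDivisors n (gapExponent n))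
        ≤ 5122 * n.divisors.card * disc (modularAPs n) ∧
      (disc (modularAPs n) : ℝ) ≤ 5122 * n.divisors.card *
        (n : ℝ) ^ (1 / 3 + minOverDivisors n (gapExponent n)) := by
  have hn0 : n ≠ 0 := NeZero.ne n
  have hn1 : (1 : ℝ) < n := by exact_mod_cast hn
  have hd : (1 : ℝ) ≤ n.divisors.card := by
    exact_mod_cast (Nat.nonempty_divisors.2 hn0).card_pos
  constructor
  · obtain ⟨r, hr, h⟩ := exists_dvd_add_sqrt_le_disc n
    have hx : minOverDivisors n (gapExponent n) ≤ gapExponent n r := Finset.inf'_le _ hr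
    have hsq : √(n.divisors.card : ℝ) ≤ n.divisors.card := by
      rw [Real.sqrt_le_left (by positivity)]
      nlinarith
    calc (n : ℝ) ^ (1 / 3 + minOverDivisors n (gapExponent n))
        ≤ (n : ℝ) ^ (1 / 3 + gapExponent n r) :=
          Real.rpow_le_rpow_of_exponent_le hn1.le (by linarith)
      _ ≤ 8 * √n.divisors.card * disc (modularAPs n) :=
          (rpow_gapExponent_bounds hn (Nat.pos_of_mem_divisors hr)).1.trans h
      _ ≤ 5122 * n.divisors.card * disc (modularAPs n) := by
          refine mul_le_mul_of_nonneg_right ?_ (by positivity)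
          linarith
  · obtain ⟨r, hr, hx⟩ := Finset.exists_mem_eq_inf' (Nat.nonempty_divisors.2 hn0) (gapExponent n)
    have hx' : minOverDivisors n (gapExponent n) = gapExponent n r := hx
    have hrn := Nat.dvd_of_mem_divisors hr
    have hr0 := Nat.pos_of_mem_divisors hr
    have hω : (2 : ℝ) ^ ω r ≤ n.divisors.card := by
      have := (two_pow_cardDistinctFactors_le_card_divisors hr0.ne').trans
        (Finset.card_le_card (Nat.divisors_subset_of_dvd hn0 hrn))
      exact_mod_cast this
    rw [hx']
    have hb := (rpow_gapExponent_bounds hn hr0).2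
    have hs : 0 ≤ √(r : ℝ) := Real.sqrt_nonneg _
    have hq : 0 ≤ (n : ℝ) / r := by positivity
    calc (disc (modularAPs n) : ℝ) ≤ (n : ℝ) / r + 2561 * √r * 2 ^ ω r := disc_modularAPs_le hrn
      _ ≤ (n : ℝ) / r + 2561 * √r * n.divisors.card := by gcongr
      _ ≤ 2561 * n.divisors.card * ((n : ℝ) / r + √r) := by nlinarith
      _ ≤ 2561 * n.divisors.card * (2 * (n : ℝ) ^ (1 / 3 + gapExponent n r)) := by gcongr
      _ = _ := by ring

theorem disc_modularAPs_pos (n : ℕ) [NeZero n] : (0 : ℝ) < disc (modularAPs n) := by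
  obtain ⟨r, hr, h⟩ := exists_dvd_add_sqrt_le_disc n
  have hr0 : (0 : ℝ) < r := by exact_mod_cast Nat.pos_of_mem_divisors hr
  have h1 : 0 < (n : ℝ) / r + √r := by positivity
  by_contra h2
  have h3 : 8 * √(n.divisors.card : ℝ) * (disc (modularAPs n) : ℝ) ≤ 0 :=
    mul_nonpos_of_nonneg_of_nonpos (by positivity) (not_lt.1 h2)
  linarith

theorem abs_log_disc_div_log_sub_le {n : ℕ} [NeZero n] (hn : 2 ≤ n) :
    |Real.log (disc (modularAPs n)) / Real.log n
        - (1 / 3 + minOverDivisors n (gapExponent n))|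
      ≤ Real.log (5122 * n.divisors.card) / Real.log n := by
  have hn1 : (1 : ℝ) < n := by exact_mod_cast hn
  have hn0 : (0 : ℝ) < n := by linarith
  have hln : 0 < Real.log n := Real.log_pos hn1
  have hd : (0 : ℝ) < n.divisors.card := by
    exact_mod_cast (Nat.nonempty_divisors.2 (NeZero.ne n)).card_pos
  have hD := disc_modularAPs_pos n
  obtain ⟨h1, h2⟩ := disc_modularAPs_rpow_bounds hn
  set e := 1 / 3 + minOverDivisors n (gapExponent n)
  have k1 := Real.log_le_log (by positivity) h1
  have k2 := Real.log_le_log hD h2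
  rw [Real.log_mul (by positivity) hD.ne', Real.log_rpow hn0] at k1
  rw [Real.log_mul (by positivity) (by positivity), Real.log_rpow hn0] at k2
  rw [div_sub' hln.ne', abs_div, abs_of_pos hln]
  gcongr
  rw [abs_le]
  constructor <;> linarith

theorem exists_gap_exponents :
    ∃ x δ : ℕ → ℝ,
      (∀ n : ℕ, 2 ≤ n → IsGreatest (divisorGaps n) (x n)) ∧
      Filter.Tendsto δ Filter.atTop (nhds 0) ∧
      ∀ (n : ℕ) [NeZero n], 2 ≤ n →
        (disc (modularAPs n) : ℝ) = (n : ℝ) ^ (1 / 3 + x n + δ n) := by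
  classical
  let x : ℕ → ℝ := fun n => if h : n ≠ 0 then
    haveI : NeZero n := ⟨h⟩
    minOverDivisors n (gapExponent n) else 0
  let δ : ℕ → ℝ := fun n => if h : n ≠ 0 then
    haveI : NeZero n := ⟨h⟩
    Real.log (disc (modularAPs n)) / Real.log n - (1 / 3 + x n) else 0
  have hx : ∀ (n : ℕ) [NeZero n], x n = minOverDivisors n (gapExponent n) := fun n _ =>
    dif_pos (NeZero.ne n)
  have hδ : ∀ (n : ℕ) [NeZero n], δ n
      = Real.log (disc (modularAPs n)) / Real.log n - (1 / 3 + x n) := fun n _ =>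
    dif_pos (NeZero.ne n)
  refine ⟨x, δ, fun n hn => ?_, ?_, fun n _ hn => ?_⟩
  · have : NeZero n := ⟨by omega⟩
    rw [hx]
    exact isGreatest_divisorGaps hn
  · refine squeeze_zero_norm' ?_ (tendsto_log_mul_card_divisors_div_log (C := 5122) (by norm_num))
    filter_upwards [Filter.eventually_ge_atTop 2] with n hn
    have : NeZero n := ⟨by omega⟩
    rw [hδ, hx, Real.norm_eq_abs]
    exact abs_log_disc_div_log_sub_le hn
  · have hn1 : (1 : ℝ) < n := by exact_mod_cast hn
    have hln : 0 < Real.log n := Real.log_pos hn1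
    rw [hδ, add_sub_cancel, Real.rpow_def_of_pos (by linarith), mul_div_cancel₀ _ hln.ne',
      Real.exp_log (disc_modularAPs_pos n)]

theorem disc_modularAPs_bounds (n : ℕ) [NeZero n] :
    1 / (8 * √(n.divisors.card : ℝ)) * minOverDivisors n (fun r => (n : ℝ) / r + √(r : ℝ))
        ≤ (disc (modularAPs n) : ℝ) ∧
      (disc (modularAPs n) : ℝ)
        ≤ minOverDivisors n (fun r => (n : ℝ) / r + 2561 * √(r : ℝ) * 2 ^ (ω r)) := by
  constructor
  · obtain ⟨r, hr, h⟩ := exists_dvd_add_sqrt_le_disc n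
    have hd : (0 : ℝ) < n.divisors.card := by exact_mod_cast Finset.card_pos.2 ⟨r, hr⟩
    rw [one_div, inv_mul_le_iff₀ (by positivity)]
    exact (Finset.inf'_le _ hr).trans h
  · exact Finset.le_inf' _ _ fun r hr => disc_modularAPs_le (Nat.dvd_of_mem_divisors hr)

theorem disc_modularAPs_prime_bounds {n : ℕ} [NeZero n] (hn : n.Prime) :
    1 / (8 * √2) * √(n : ℝ) ≤ (disc (modularAPs n) : ℝ) ∧
      (disc (modularAPs n) : ℝ) ≤ 5123 * √(n : ℝ) := by
  have hn1 : (1 : ℝ) ≤ n := by exact_mod_cast hn.one_le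
  have hs1 : 1 ≤ √(n : ℝ) := Real.one_le_sqrt.2 hn1
  constructor
  · obtain ⟨r, hr, h⟩ := exists_dvd_add_sqrt_le_disc n
    have hcard : n.divisors.card = 2 := by
      rw [hn.divisors, Finset.card_pair hn.one_lt.ne]
    rw [hcard] at h
    push_cast at h
    rw [one_div, inv_mul_le_iff₀ (by positivity)]
    refine le_trans ?_ h
    rcases (Nat.dvd_prime hn).1 (Nat.dvd_of_mem_divisors hr) with rfl | rfl
    -- Here the divisor is `1`, and the term `n / 1` already dominates `√n`; for the divisor `n` it
    -- is the term `√n` itself.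
    · have : √(n : ℝ) ≤ n := by
        rw [Real.sqrt_le_left (by positivity)]
        nlinarith
      simp only [Nat.cast_one, div_one, Real.sqrt_one]
      linarith
    · have : 0 ≤ (r : ℝ) / r := by positivity
      linarith
  · have h := disc_modularAPs_le (dvd_refl n)
    rw [ArithmeticFunction.cardDistinctFactors_apply_prime hn, div_self (by linarith)] at h
    linarith

theorem theorem1p1 :
    (∃ c : ℝ, 0 < c ∧ ∀ (n : ℕ) [NeZero n],
      1 / (8 * √(n.divisors.card : ℝ)) * minOverDivisors n (fun r => (n : ℝ) / r + √(r : ℝ))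
          ≤ (disc (modularAPs n) : ℝ) ∧
        (disc (modularAPs n) : ℝ)
          ≤ minOverDivisors n (fun r => (n : ℝ) / r + c * √(r : ℝ) * 2 ^ (ω r))) ∧
    (∃ x δ : ℕ → ℝ,
      (∀ n : ℕ, 2 ≤ n → IsGreatest (divisorGaps n) (x n)) ∧
      Filter.Tendsto δ Filter.atTop (nhds 0) ∧
      ∀ (n : ℕ) [NeZero n], 2 ≤ n →
        (disc (modularAPs n) : ℝ) = (n : ℝ) ^ (1 / 3 + x n + δ n)) ∧
    (∃ c₁ c₂ : ℝ, 0 < c₁ ∧ 0 < c₂ ∧ ∀ (n : ℕ) [NeZero n], n.Prime →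
      c₁ * √(n : ℝ) ≤ (disc (modularAPs n) : ℝ) ∧
        (disc (modularAPs n) : ℝ) ≤ c₂ * √(n : ℝ)) :=
  ⟨⟨2561, by norm_num, fun n _ => disc_modularAPs_bounds n⟩, exists_gap_exponents,
    1 / (8 * √2), 5123, by positivity, by norm_num,
    fun n _ hn => disc_modularAPs_prime_bounds hn⟩
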